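/- **Setting.** For a unit vector $v\in\mathbb R^2$ and $\ell\in(0,1)$ the cone with axis $v$ and coefficient $\ell$ is $\{u : |u\cdot v|\ge \ell\|u\|\}$. A universal pair of cones $K^u,K^s$ consists of a cone $K^u$ with axis $\langle 1,0\rangle$ and a cone $K^s$ with axis $\langle 0,1\rangle$ such that $K^u\cap K^s=\{0\}$. A cone-field on $\mathbb R^2$ assigns to each $P$ a cone whose axis and coefficient depend continuously on $P$. Two $C^1$ diffeomorphisms $F_1,F_2:\mathbb R^2\to\mathbb R^2$, both orientation preserving or both orientation reversing, are *synchronously hyperbolic* if there are $\lambda>1$, a universal pair $K^u,K^s$ and cone-fields $(K^u_P)$, $(K^s_P)$ such that for all $P$ and $i=1,2$: (S1) $K^u_P\subset K^u$, $K^s_P\subset K^s$, $D(F_i)_P(K^u_P)\subset K^u_{F_i(P)}$, $D(F_i^{-1})_P(K^s_P)\subset K^s_{F_i^{-1}(P)}$; (S2) $\|D(F_i)_P u\|\ge\lambda\|u\|$ for $u\in K^u_P$ and $\|D(F_i^{-1})_P w\|\ge\lambda\|w\|$ for $w\in K^s_P$; (S3) there is a $C^1$ curve $\Gamma=\{(g(y),y):y\in\mathbb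 R\}$ (the divider) such that for every $P\in\Gamma$: $F_1(P)=F_2(P)$, the tangent vector of $\Gamma$ at $P$ is in $K^s_P$, and the tangent vector of $F_i(\Gamma)$ at $F_i(P)$ is in $K^u_{F_i(P)}$. The left and right half-planes are $\{x<g(y)\}$ and $\{x>g(y)\}$. Let $F=F_1$ on the left half-plane, $F=F_2$ on the right one, and $F=F_1=F_2$ on $\Gamma$. The map $F$ is *Lozi-like* if (L1) $-1<\det DF_i(P)<0$ for all $P$ and $i=1,2$, and (L2) there is a trapping region $\Delta$ (a nonempty set with $F(\overline\Delta)\subset\operatorname{Int}\Delta$) that is homeomorphic to an open disk and whose closure is homeomorphic to a closed disk. **Lemma.** Let $F$ be Lozi-like and let $\Delta$ be any trapping region as in (L2). Then: (P1) $\Delta\cap\Gamma\neq\emptyset$ and $\Delta\cap F(\Gamma)\neq\emptyset$. (P2) $F$ has a unique fixed point $X$ in $\Delta$. Suppose that $X$ lies in the right half-plane (if it lies in the left half-plane, (P3) holds as it stands, and (P4) holds with $F_2$ and the right half-plane in place of $F_1$ and the left half-plane). (P3) $DF(X)$ has eigenvalues $\lambda_1<-1$ and $0<\lambda_2<1$.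 (P4) Let $P$ be in the left half-plane. Then $F$ is differentiable at $P$ with $DF(P)=DF_1(P)$, and the unstable eigenvalue of $DF_1(P)$ is $>1$ and the stable one is $<0$, in the following sense. (a) If $\hat\lambda_1,\hat\lambda_2$ are eigenvalues of $DF_1(P)$ with $|\hat\lambda_1|>1$, $|\hat\lambda_2|<1$, and $\hat\lambda_1$ has an eigenvector in the unstable cone $K^u$, then $\hat\lambda_1>1$ and $\hat\lambda_2<0$. (b) If $F_1(P)=P$, then $DF_1(P)$ has eigenvalues $\hat\lambda_1>1$ and $-1<\hat\lambda_2<0$. (c) For each unit vector $e\in K^u_P$ with positive first coordinate there are a unit vector $e'\in K^u_{F_1(P)}$ with positive first coordinate and a number $\hat\lambda_1>1$ with $DF_1(P)e=\hat\lambda_1e'$. For each unit vector $e'\in K^s_{F_1(P)}$ with positive second coordinate there are a unit vector $e\in K^s_P$ with positive second coordinate and a number $\hat\lambda_2\in(-1,0)$ with $DF_1(P)e=\hat\lambda_2e'$. (P5) In all cases $X\notin\Gamma\cap F(\Gamma)$, and moreover $X\notin\Gamma\cup F(\Gamma)$. -/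

import Mathlib

open Set

open scoped Manifold ContDiff

namespace LoziLike

/-- The plane `ℝ²` with its Euclidean norm and inner product. -/
abbrev Plane : Type := EuclideanSpace ℝ (Fin 2)

/-- `C¹` diffeomorphisms of the plane onto itself. -/
abbrev PlaneDiffeo : Type := Plane ≃ₘ^1⟮𝓘(ℝ, Plane), 𝓘(ℝ, Plane)⟯ Plane

/-- The cone `{u : |u · v| ≥ ℓ ‖u‖}` (`v` is a unit vector and `0 < ℓ < 1` wherever it is used). -/
def cone (v : Plane) (l : ℝ) : Set Plane := {u | l * ‖u‖ ≤ |inner ℝ u v|}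

/-- A cone-field on the whole plane: the (unit) axis vector and the coefficient of the cone
at `P` depend continuously on `P`. -/
structure ConeField where
  axis : Plane → Plane
  coeff : Plane → ℝ
  norm_axis : ∀ P, ‖axis P‖ = 1
  coeff_mem : ∀ P, coeff P ∈ Ioo (0 : ℝ) 1
  continuous_axis : Continuous axis
  continuous_coeff : Continuous coeff

/-- The cone that a cone-field assigns to a point. -/
def ConeField.at (C : ConeField) (P : Plane) : Set Plane := cone (C.axis P) (C.coeff P)

/-- A universal pair of cones, given by the two coefficients: the axis of `Ku` is the `x`-axis,
the axis of `Ks` is the `y`-axis, and the cones have only the zero vector in common. -/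
structure UniversalPair where
  coeffU : ℝ
  coeffS : ℝ
  coeffU_mem : coeffU ∈ Ioo (0 : ℝ) 1
  coeffS_mem : coeffS ∈ Ioo (0 : ℝ) 1
  disjoint : cone !₂[1, 0] coeffU ∩ cone !₂[0, 1] coeffS = {0}

/-- The unstable cone of a universal pair. -/
def UniversalPair.Ku (K : UniversalPair) : Set Plane := cone !₂[1, 0] K.coeffU

/-- The stable cone of a universal pair. -/
def UniversalPair.Ks (K : UniversalPair) : Set Plane := cone !₂[0, 1] K.coeffS

/-- `G` preserves the orientation of the plane. -/
def OrientationPreserving (G : PlaneDiffeo) : Prop := ∀ P : Plane, 0 < (fderiv ℝ G P).det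

/-- `G` reverses the orientation of the plane. -/
def OrientationReversing (G : PlaneDiffeo) : Prop := ∀ P : Plane, (fderiv ℝ G P).det < 0

/-- Conditions (S1) and (S2) for one diffeomorphism `G`: invariance of the cone-fields and
expansion of the unstable (stable) cones by `DG` (by `D(G⁻¹)`) by the factor `lam`. -/
structure HyperbolicFor (G : PlaneDiffeo) (lam : ℝ) (Cu Cs : ConeField) : Prop where
  map_unstable : ∀ P, ∀ u ∈ Cu.at P, fderiv ℝ G P u ∈ Cu.at (G P)
  map_stable : ∀ P, ∀ w ∈ Cs.at P, fderiv ℝ G.symm P w ∈ Cs.at (G.symm P)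
  expand_unstable : ∀ P, ∀ u ∈ Cu.at P, lam * ‖u‖ ≤ ‖fderiv ℝ G P u‖
  expand_stable : ∀ P, ∀ w ∈ Cs.at P, lam * ‖w‖ ≤ ‖fderiv ℝ G.symm P w‖

/-- `F₁` and `F₂` are synchronously hyperbolic; the structure records the constant, the cones,
the cone-fields and the divider. A `C¹` curve that is infinite in both directions and whose
tangent vectors lie in `Ks` is the graph `x = g y` of a `C¹` function `g : ℝ → ℝ`; its tangent
vector at `(g y, y)` is `(g' y, 1)`, and the tangent vector of its image under `F₁` or `F₂` is the
image of that vector under the derivative. -/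
structure SynchronouslyHyperbolic (F₁ F₂ : PlaneDiffeo) where
  orientation : (OrientationPreserving F₁ ∧ OrientationPreserving F₂) ∨
    (OrientationReversing F₁ ∧ OrientationReversing F₂)
  lam : ℝ
  one_lt_lam : 1 < lam
  K : UniversalPair
  Cu : ConeField
  Cs : ConeField
  unstable_subset : ∀ P, Cu.at P ⊆ K.Ku
  stable_subset : ∀ P, Cs.at P ⊆ K.Ks
  hyperbolic₁ : HyperbolicFor F₁ lam Cu Cs
  hyperbolic₂ : HyperbolicFor F₂ lam Cu Cs
  g : ℝ → ℝ
  contDiff_g : ContDiff ℝ 1 g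
  agree : ∀ y : ℝ, F₁ !₂[g y, y] = F₂ !₂[g y, y]
  tangent : ∀ y : ℝ, !₂[deriv g y, 1] ∈ Cs.at !₂[g y, y]
  tangent_image₁ : ∀ y : ℝ,
    fderiv ℝ F₁ !₂[g y, y] !₂[deriv g y, 1] ∈ Cu.at (F₁ !₂[g y, y])
  tangent_image₂ : ∀ y : ℝ,
    fderiv ℝ F₂ !₂[g y, y] !₂[deriv g y, 1] ∈ Cu.at (F₂ !₂[g y, y])

namespace SynchronouslyHyperbolic

variable {F₁ F₂ : PlaneDiffeo} (H : SynchronouslyHyperbolic F₁ F₂)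

/-- The divider `Γ`. -/
def divider : Set Plane := {P | P 0 = H.g (P 1)}

/-- The (open) left half-plane. -/
def left : Set Plane := {P | P 0 < H.g (P 1)}

/-- The (open) right half-plane. -/
def right : Set Plane := {P | H.g (P 1) < P 0}

open Classical in
/-- The map `F`, equal to `F₁` in the left and to `F₂` in the right half-plane
(on the divider `F₁` and `F₂` agree). -/
noncomputable def map (P : Plane) : Plane := if P 0 ≤ H.g (P 1) then F₁ P else F₂ P

end SynchronouslyHyperbolic

/-- A trapping region: a nonempty set that is mapped with its closure into its interior. -/
def IsTrappingRegion (F : Plane → Plane) (D : Set Plane) : Prop :=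
  D.Nonempty ∧ F '' closure D ⊆ interior D

/-- A trapping region that is homeomorphic to an open disk and whose closure is homeomorphic
to a closed disk. -/
structure IsDiskTrappingRegion (F : Plane → Plane) (D : Set Plane) : Prop where
  trapping : IsTrappingRegion F D
  openDisk : Nonempty (D ≃ₜ Metric.ball (0 : Plane) 1)
  closedDisk : Nonempty (closure D ≃ₜ Metric.closedBall (0 : Plane) 1)

/-- The map `H.map` is Lozi-like: conditions (L1) and (L2). -/
structure IsLoziLike {F₁ F₂ : PlaneDiffeo} (H : SynchronouslyHyperbolic F₁ F₂) : Prop where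
  det₁ : ∀ P : Plane, (fderiv ℝ F₁ P).det ∈ Ioo (-1 : ℝ) 0
  det₂ : ∀ P : Plane, (fderiv ℝ F₂ P).det ∈ Ioo (-1 : ℝ) 0
  exists_trapping : ∃ D : Set Plane, IsDiskTrappingRegion H.map D

/-- `A` has eigenvalues `lam₁ < -1` and `0 < lam₂ < 1`. -/
def HasFlippingEigenvalues (A : Plane →L[ℝ] Plane) : Prop :=
  ∃ lam₁ lam₂ : ℝ, Module.End.HasEigenvalue (A : Plane →ₗ[ℝ] Plane) lam₁ ∧
    Module.End.HasEigenvalue (A : Plane →ₗ[ℝ] Plane) lam₂ ∧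
    lam₁ < -1 ∧ 0 < lam₂ ∧ lam₂ < 1

/-- The derivative of `G` at `P` has unstable eigenvalue `> 1` and stable eigenvalue `< 0`.
`eigen` speaks of the eigenvalues of the matrix `DG(P)` itself, `fixed` adds that they exist if
`P` is a fixed point of `G`, and `unstable`, `stable` speak of the multipliers of `DG(P)` from
directions at `P` to directions at `G P`, directions in the unstable cones being oriented to the
right and directions in the stable cones upwards. -/
structure HasPreservingEigenvalues {F₁ F₂ : PlaneDiffeo} (H : SynchronouslyHyperbolic F₁ F₂)
    (G : PlaneDiffeo) (P : Plane) : Prop where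
  eigen : ∀ (lam₁ lam₂ : ℝ) (v w : Plane),
    Module.End.HasEigenvector (fderiv ℝ G P : Plane →ₗ[ℝ] Plane) lam₁ v →
    Module.End.HasEigenvector (fderiv ℝ G P : Plane →ₗ[ℝ] Plane) lam₂ w →
    v ∈ H.K.Ku → 1 < |lam₁| → |lam₂| < 1 → 1 < lam₁ ∧ lam₂ < 0
  fixed : G P = P → ∃ lam₁ lam₂ : ℝ,
    Module.End.HasEigenvalue (fderiv ℝ G P : Plane →ₗ[ℝ] Plane) lam₁ ∧
    Module.End.HasEigenvalue (fderiv ℝ G P : Plane →ₗ[ℝ] Plane) lam₂ ∧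
    1 < lam₁ ∧ -1 < lam₂ ∧ lam₂ < 0
  unstable : ∀ e ∈ H.Cu.at P, ‖e‖ = 1 → 0 < e 0 →
    ∃ e' ∈ H.Cu.at (G P), ‖e'‖ = 1 ∧ 0 < e' 0 ∧
      ∃ lam₁ : ℝ, 1 < lam₁ ∧ fderiv ℝ G P e = lam₁ • e'
  stable : ∀ e' ∈ H.Cs.at (G P), ‖e'‖ = 1 → 0 < e' 1 →
    ∃ e ∈ H.Cs.at P, ‖e‖ = 1 ∧ 0 < e 1 ∧
      ∃ lam₂ : ℝ, -1 < lam₂ ∧ lam₂ < 0 ∧ fderiv ℝ G P e = lam₂ • e'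

end LoziLike

/-! The engine is the growth of unstable arcs: curves tangent to the unstable cones along which the
first coordinate is monotone. Each branch `Fᵢ` maps such arcs to such arcs, stretches them by `lam`,
and either keeps or reverses their horizontal direction. The choice is a sign `τᵢ`, constant because
the plane is connected (`exists_hasSign`). No family of arcs of exponentially growing extent fits
into a bounded set, so no map that stretches arcs maps a trapping disk into itself.

If `τ₁ = τ₂`, the piecewise map itself stretches arcs: unstable chords are transversal to the
divider, so an arc crosses it at most once, and one-sided derivatives suffice at the crossing. Hence
the signs differ. The same argument for a single branch shows that the connected set `Δ` cannot miss
the divider.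

Brouwer's theorem on the closed disk gives a fixed point, which trapping puts into `Δ`. Let `τ₁ =
1`. A fixed point in the closed left half-plane would emit a half arc to the left, and `F₁` would
keep that arc on the left and in `Δ` while stretching it forever. So every fixed point in `Δ` lies
strictly on the side of the reversing branch. There uniqueness holds for any hyperbolic
diffeomorphism (`fixedPoint_unique`): a long image of an unstable arc through one fixed point
crosses a long preimage of a stable arc through the other, and the crossing point is exponentially
close to both.

At a fixed point the unstable cone is invariant and contains an eigenvector. Its eigenvalue has
modulus above 1 and sign `τ`, and the determinant in `(-1, 0)` gives the second eigenvalue. Away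
from fixed points, the negative determinant and the transversality of the universal cones make the
stable sign opposite to the unstable one. Finally, a fixed point off the divider is not an image of
a divider point, by injectivity of the branches. -/

namespace LoziLike

/-! ### Brouwer's fixed point theorem for closed disks -/

/-- A continuous nonvanishing function on the closed unit disk has a continuous logarithm. -/
theorem exists_continuousOn_log {h : ℂ → ℂ} (hc : ContinuousOn h (Metric.closedBall 0 1))
    (h0 : ∀ z ∈ Metric.closedBall (0 : ℂ) 1, h z ≠ 0) :
    ∃ θ : ℂ → ℂ, ContinuousOn θ (Metric.closedBall 0 1) ∧
      ∀ z ∈ Metric.closedBall (0 : ℂ) 1, Complex.exp (θ z) = h z := by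
  have hK : IsCompact (Metric.closedBall (0 : ℂ) 1) := isCompact_closedBall _ _
  obtain ⟨z₀, hz₀, hmin⟩ := hK.exists_isMinOn ⟨0, by simp⟩ hc.norm
  have hm : 0 < ‖h z₀‖ := norm_pos_iff.2 (h0 _ hz₀)
  obtain ⟨δ, hδ, hu⟩ := Metric.uniformContinuousOn_iff.1
    (hK.uniformContinuousOn_of_continuous hc) _ hm
  obtain ⟨n, hn⟩ := exists_nat_one_div_lt hδ
  -- The radius from 0 to `z` is cut into `n + 1` steps shorter than `δ`. Along one step `h` varies
  -- by less than its minimal modulus, so successive quotients stay within distance 1 of 1, where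
  -- the principal logarithm is continuous.
  set p : ℕ → ℂ → ℂ := fun k z => ((k / (n + 1 : ℝ) : ℝ) : ℂ) * z with hp
  have hpmem : ∀ k ≤ n + 1, ∀ z ∈ Metric.closedBall (0 : ℂ) 1,
      p k z ∈ Metric.closedBall (0 : ℂ) 1 := by
    intro k hk z hz
    simp only [hp, mem_closedBall_zero_iff, norm_mul, Complex.norm_real, Real.norm_eq_abs] at hz ⊢
    have h1 : |(k / (n + 1 : ℝ) : ℝ)| ≤ 1 := by
      rw [abs_of_nonneg (by positivity)]
      apply div_le_one_of_le₀ _ (by positivity)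
      exact_mod_cast hk
    exact mul_le_one₀ h1 (norm_nonneg _) hz
  have hpc : ∀ k ≤ n + 1, ContinuousOn (fun z => h (p k z)) (Metric.closedBall 0 1) :=
    fun k hk => hc.comp (by fun_prop) (hpmem k hk)
  have hslit : ∀ k ∈ Finset.range (n + 1), ∀ z ∈ Metric.closedBall (0 : ℂ) 1,
      h (p (k + 1) z) / h (p k z) ∈ Complex.slitPlane := by
    intro k hk z hz
    have hk' : k < n + 1 := Finset.mem_range.1 hk
    have ha := hpmem (k + 1) hk' z hz
    have hb := hpmem k hk'.le z hz
    have hd : dist (p (k + 1) z) (p k z) < δ := by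
      refine lt_of_le_of_lt ?_ hn
      have : p (k + 1) z - p k z = ((1 / (n + 1 : ℝ) : ℝ) : ℂ) * z := by
        simp only [hp]; push_cast; ring
      rw [dist_eq_norm, this, norm_mul, Complex.norm_real, Real.norm_eq_abs,
        abs_of_nonneg (by positivity)]
      exact mul_le_of_le_one_right (by positivity) (by simpa using hz)
    have h2 := hu _ ha _ hb hd
    have h3 : ‖h z₀‖ ≤ ‖h (p k z)‖ := hmin hb
    have hne := h0 _ hb
    have h4 : ‖h (p (k + 1) z) / h (p k z) - 1‖ < 1 := by
      rw [div_sub_one hne, norm_div, div_lt_one (norm_pos_iff.2 hne), ← dist_eq_norm]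
      exact h2.trans_le h3
    left
    have h5 := (Complex.abs_re_le_norm _).trans_lt h4
    rw [Complex.sub_re, Complex.one_re, abs_lt] at h5
    linarith
  -- After exponentiation the quotients telescope to `h z / h 0`.
  refine ⟨fun z => Complex.log (h 0) +
    ∑ k ∈ Finset.range (n + 1), Complex.log (h (p (k + 1) z) / h (p k z)), ?_, ?_⟩
  · refine continuousOn_const.add (continuousOn_finsetSum _ fun k hk => ?_)
    have hk' : k < n + 1 := Finset.mem_range.1 hk
    exact ((hpc _ hk').div (hpc _ hk'.le) fun z hz => h0 _ (hpmem _ hk'.le z hz)).clog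
      (hslit k hk)
  · intro z hz
    rw [Complex.exp_add, Complex.exp_log (h0 0 (by simp)), Complex.exp_sum]
    have h1 : ∀ m ≤ n + 1, h 0 * ∏ k ∈ Finset.range m,
        Complex.exp (Complex.log (h (p (k + 1) z) / h (p k z))) = h (p m z) := by
      intro m
      induction m with
      | zero => intro _; simp [hp]
      | succ m ih =>
        intro hm
        have hne := h0 _ (hpmem m (by omega) z hz)
        have hne' := h0 _ (hpmem (m + 1) hm z hz)
        rw [Finset.prod_range_succ, ← mul_assoc, ih (by omega),
          Complex.exp_log (div_ne_zero hne' hne), mul_div_cancel₀ _ hne]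
    rw [h1 _ le_rfl]
    have : p (n + 1) z = z := by
      have h6 : ((n + 1 : ℕ) / (n + 1 : ℝ) : ℝ) = 1 := by push_cast; exact div_self (by positivity)
      simp only [hp, h6]; simp
    rw [this]

/-- There is no continuous logarithm of the identity on the unit circle. -/
theorem not_exists_log_on_circle (θ : ℂ → ℂ) (hc : ContinuousOn θ (Metric.sphere 0 1))
    (hθ : ∀ z ∈ Metric.sphere (0 : ℂ) 1, Complex.exp (θ z) = z) : False := by
  have hmem : ∀ t : ℝ, Complex.exp (t * Complex.I) ∈ Metric.sphere (0 : ℂ) 1 := by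
    intro t; simp [Complex.norm_exp_ofReal_mul_I]
  -- This function is continuous with values in the integer multiples of `2πi`, yet drops by `2πi`
  -- over one turn.
  set φ : ℝ → ℂ := fun t => θ (Complex.exp (t * Complex.I)) - t * Complex.I with hφ
  have hφc : Continuous φ := by
    refine Continuous.sub ?_ (by fun_prop)
    exact hc.comp_continuous (by fun_prop) hmem
  have hint : ∀ t, ∃ n : ℤ, φ t = n * (2 * Real.pi * Complex.I) := by
    intro t
    rw [← Complex.exp_eq_one_iff, hφ]
    simp only
    rw [Complex.exp_sub, hθ _ (hmem t), div_self (Complex.exp_ne_zero _)]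
  have him : ∀ t, ∃ n : ℤ, (φ t).im = n * (2 * Real.pi) := by
    intro t
    obtain ⟨n, hn⟩ := hint t
    refine ⟨n, ?_⟩
    rw [hn]; simp
  have hshift : (φ (2 * Real.pi)).im = (φ 0).im - 2 * Real.pi := by
    have : Complex.exp (((2 * Real.pi : ℝ) : ℂ) * Complex.I) = Complex.exp (((0 : ℝ) : ℂ) * Complex.I) := by
      push_cast; rw [Complex.exp_two_pi_mul_I]; simp
    simp only [hφ, this]; simp
  obtain ⟨n, hn⟩ := him 0
  have hpi := Real.pi_pos
  have hivt := intermediate_value_Icc' (f := fun t => (φ t).im) (by positivity : (0 : ℝ) ≤ 2 * Real.pi)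
    (by fun_prop)
  -- The value halfway between the two ends is not an admissible multiple.
  obtain ⟨t, -, ht⟩ := hivt (show (φ 0).im - Real.pi ∈ _ from ⟨by simp only [hshift]; linarith, by linarith⟩)
  obtain ⟨m, hm⟩ := him t
  simp only at ht
  rw [hm, hn] at ht
  have h2 : (2 * m : ℝ) = 2 * n - 1 := by
    have : Real.pi * (2 * m - 2 * n + 1) = 0 := by linarith
    rcases mul_eq_zero.1 this with h | h
    · exact absurd h hpi.ne'
    · linarith
  have h3 : 2 * m = 2 * n - 1 := by exact_mod_cast h2
  omega

/-- Brouwer's fixed point theorem for the closed unit disk of `ℂ`. -/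
theorem exists_fixedPoint_closedBall_complex (f : ℂ → ℂ)
    (hc : ContinuousOn f (Metric.closedBall 0 1))
    (hf : MapsTo f (Metric.closedBall 0 1) (Metric.closedBall 0 1)) :
    ∃ z ∈ Metric.closedBall (0 : ℂ) 1, f z = z := by
  by_contra! hne
  obtain ⟨θ, hθc, hθ⟩ := exists_continuousOn_log (h := fun z => z - f z) (continuousOn_id.sub hc)
    fun z hz => sub_ne_zero.2 (hne z hz).symm
  have hsub : Metric.sphere (0 : ℂ) 1 ⊆ Metric.closedBall 0 1 := Metric.sphere_subset_closedBall
  have hz0 : ∀ z ∈ Metric.sphere (0 : ℂ) 1, z ≠ 0 := by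
    rintro z hz rfl; simp at hz
  -- On the circle `f z / z` has norm at most 1, so its real part reaches 1 only when `f z = z`.
  have hslit : ∀ z ∈ Metric.sphere (0 : ℂ) 1, 1 - f z / z ∈ Complex.slitPlane := by
    intro z hz
    left
    have h1 : ‖f z / z‖ ≤ 1 := by
      rw [norm_div, mem_sphere_zero_iff_norm.1 hz, div_one]
      simpa using hf (hsub hz)
    have h2 : (f z / z).re ≤ 1 := (Complex.re_le_norm _).trans h1
    rcases h2.lt_or_eq with h3 | h3
    · simpa using h3
    · exfalso
      have h4 : f z / z = 1 := by
        have h5 : (f z / z).im ^ 2 ≤ 0 := by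
          have := Complex.sq_norm (f z / z)
          rw [Complex.normSq_apply, h3] at this
          nlinarith [norm_nonneg (f z / z)]
        apply Complex.ext
        · simpa using h3
        · have := pow_eq_zero_iff (two_ne_zero) |>.1 (le_antisymm h5 (sq_nonneg _))
          simpa using this
      exact hne z (hsub hz) (by rwa [div_eq_one_iff_eq (hz0 z hz)] at h4)
  -- Since `z - f z = z * (1 - f z / z)`, this difference is a logarithm of `z`.
  refine not_exists_log_on_circle (fun z => θ z - Complex.log (1 - f z / z)) ?_ ?_
  · refine (hθc.mono hsub).sub (ContinuousOn.clog ?_ hslit)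
    exact continuousOn_const.sub ((hc.mono hsub).div continuousOn_id hz0)
  · intro z hz
    have hw := Complex.slitPlane_ne_zero (hslit z hz)
    rw [Complex.exp_sub, hθ z (hsub hz), Complex.exp_log hw, div_eq_iff hw]
    field_simp [hz0 z hz]

open Classical in
/-- Brouwer's fixed point theorem for sets homeomorphic to a closed disk of the plane. -/
theorem exists_fixedPoint_of_homeomorph_closedBall {S : Set Plane}
    (e : S ≃ₜ Metric.closedBall (0 : Plane) 1) {f : Plane → Plane} (hf : ContinuousOn f S)
    (hm : MapsTo f S S) : ∃ P ∈ S, f P = P := by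
  let L := Complex.orthonormalBasisOneI.repr
  have hL : ∀ z : ℂ, z ∈ Metric.closedBall (0 : ℂ) 1 → L z ∈ Metric.closedBall (0 : Plane) 1 := by
    intro z hz; simpa using hz
  have hL' : ∀ z : Plane, z ∈ Metric.closedBall (0 : Plane) 1 →
      L.symm z ∈ Metric.closedBall (0 : ℂ) 1 := by
    intro z hz; simpa using hz
  let k : Metric.closedBall (0 : ℂ) 1 → Metric.closedBall (0 : ℂ) 1 := fun z =>
    ⟨L.symm (e (hm.restrict f S S (e.symm ⟨L z, hL z z.2⟩))), hL' _ (Subtype.coe_prop _)⟩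
  have hk : Continuous k := by
    have h1 : Continuous (hm.restrict f S S) := hf.mapsToRestrict hm
    refine Continuous.subtype_mk ?_ _
    refine L.symm.continuous.comp (continuous_subtype_val.comp (e.continuous.comp (h1.comp
      (e.symm.continuous.comp (Continuous.subtype_mk (by fun_prop) _)))))
  -- Makes `k` a total function on `ℂ`; the value outside the disk plays no role.
  let r : ℂ → Metric.closedBall (0 : ℂ) 1 := fun z =>
    if h : z ∈ Metric.closedBall (0 : ℂ) 1 then ⟨z, h⟩ else ⟨0, by simp⟩
  have hr : ∀ z (h : z ∈ Metric.closedBall (0 : ℂ) 1), r z = ⟨z, h⟩ := fun z h => dif_pos h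
  obtain ⟨z, hz, hfz⟩ := exists_fixedPoint_closedBall_complex (fun z => (k (r z) : ℂ)) (by
      rw [continuousOn_iff_continuous_domRestrict]
      have : (Metric.closedBall (0 : ℂ) 1).domRestrict (fun z => (k (r z) : ℂ)) = fun z => (k z : ℂ) := by
        ext z; simp [domRestrict, hr z z.2]
      rw [this]; exact continuous_subtype_val.comp hk) (fun z _ => Subtype.coe_prop _)
  simp only [hr z hz] at hfz
  refine ⟨e.symm ⟨L z, hL z hz⟩, Subtype.coe_prop _, ?_⟩
  have h1 : (e (hm.restrict f S S (e.symm ⟨L z, hL z hz⟩)) : Plane) = L z := by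
    have h3 : L (k ⟨z, hz⟩) = L z := congrArg L hfz
    exact Eq.trans (by simp [k]) h3
  have h2 : hm.restrict f S S (e.symm ⟨L z, hL z hz⟩) = e.symm ⟨L z, hL z hz⟩ := by
    apply e.injective; apply Subtype.ext; rw [h1]; simp
  exact congrArg Subtype.val h2

/-! ### Diffeomorphisms and cones -/

theorem PlaneDiffeo.contDiff (G : PlaneDiffeo) : ContDiff ℝ 1 G :=
  contMDiff_iff_contDiff.1 G.contMDiff

theorem PlaneDiffeo.hasFDerivAt (G : PlaneDiffeo) (P : Plane) :
    HasFDerivAt G (fderiv ℝ G P) P :=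
  ((G.contDiff.differentiable one_ne_zero) P).hasFDerivAt

theorem PlaneDiffeo.apply_fderiv_symm (G : PlaneDiffeo) (P u : Plane) :
    fderiv ℝ G P (fderiv ℝ G.symm (G P) u) = u := by
  have hP : HasFDerivAt G (fderiv ℝ G P) (G.symm (G P)) := by
    rw [G.symm_apply_apply]; exact G.hasFDerivAt P
  have h := hP.comp (G P) (PlaneDiffeo.hasFDerivAt G.symm (G P))
  have h2 : (G : Plane → Plane) ∘ G.symm = id := by
    ext1 x; exact G.apply_symm_apply x
  rw [h2] at h
  have := h.unique (hasFDerivAt_id _)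
  simpa using congrArg (fun A : Plane →L[ℝ] Plane => A u) this

theorem smul_mem_cone {v u : Plane} {l : ℝ} (r : ℝ) (hu : u ∈ cone v l) : r • u ∈ cone v l := by
  simp only [cone, mem_ofPred_eq, norm_smul, inner_smul_left, abs_mul, Real.norm_eq_abs] at hu ⊢
  have := mul_le_mul_of_nonneg_left hu (abs_nonneg r)
  simp only [RCLike.conj_to_real]
  linarith

theorem ConeField.smul_mem (C : ConeField) {P u : Plane} (r : ℝ) (hu : u ∈ C.at P) :
    r • u ∈ C.at P := smul_mem_cone r hu

theorem ConeField.axis_mem (C : ConeField) (P : Plane) : C.axis P ∈ C.at P := by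
  simp only [ConeField.at, cone, mem_ofPred_eq, C.norm_axis, real_inner_self_eq_norm_sq]
  simpa using (C.coeff_mem P).2.le

theorem ConeField.axis_ne_zero (C : ConeField) (P : Plane) : C.axis P ≠ 0 := by
  rw [← norm_ne_zero_iff, C.norm_axis]; exact one_ne_zero

/-- A linear functional that does not vanish on a cone has constant sign on each half of it. -/
theorem inner_mul_pos_of_ne_zero_on_cone {a : Plane} {l : ℝ} (ha : ‖a‖ = 1) (hl : l ∈ Ioo (0 : ℝ) 1)
    (φ : Plane →L[ℝ] ℝ) (hφ : ∀ u ∈ cone a l, u ≠ 0 → φ u ≠ 0) {u : Plane} (hu : u ∈ cone a l)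
    (hu0 : u ≠ 0) : 0 < inner ℝ u a * (φ u * φ a) := by
  wlog hpos : 0 < inner ℝ u a generalizing u
  · have hne : inner ℝ u a ≠ 0 := by
      intro h0
      simp only [cone, mem_ofPred_eq, h0, abs_zero] at hu
      have := mul_pos hl.1 (norm_pos_iff.2 hu0)
      linarith
    have hneg : inner ℝ u a < 0 := lt_of_le_of_ne (not_lt.1 hpos) hne
    have h1 : -u ∈ cone a l := by simpa using smul_mem_cone (-1) hu
    have := this h1 (neg_ne_zero.2 hu0) (by simpa using hneg)
    simpa using this
  refine mul_pos hpos ?_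
  have haa : inner ℝ a a = (1 : ℝ) := by rw [real_inner_self_eq_norm_sq, ha]; norm_num
  have hac : a ∈ cone a l := by
    simp only [cone, mem_ofPred_eq, ha, haa, abs_one]; linarith [hl.2]
  have ha0 : φ a ≠ 0 := hφ a hac (by rw [← norm_ne_zero_iff, ha]; exact one_ne_zero)
  have hφu := hφ u hu hu0
  by_contra hcon
  have hlt : φ u * φ a < 0 := lt_of_le_of_ne (not_lt.1 hcon) (mul_ne_zero hφu ha0)
  have hd : φ u - φ a ≠ 0 := by
    intro h
    rw [sub_eq_zero.1 h] at hlt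
    exact absurd hlt (not_lt.2 (mul_self_nonneg _))
  -- Opposite signs at `u` and `a` would make `φ` vanish at this parameter of the segment from `u`
  -- to `a`, which stays in one convex half of the cone.
  set t := φ u / (φ u - φ a) with ht
  have ht0 : 0 ≤ t := by
    have : t = (φ u * φ u - φ u * φ a) / (φ u - φ a) ^ 2 := by rw [ht]; field_simp
    rw [this]; apply div_nonneg _ (sq_nonneg _); nlinarith [mul_self_nonneg (φ u)]
  have ht1 : 0 ≤ 1 - t := by
    have : 1 - t = (φ a * φ a - φ u * φ a) / (φ u - φ a) ^ 2 := by rw [ht]; field_simp; ring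
    rw [this]; apply div_nonneg _ (sq_nonneg _); nlinarith [mul_self_nonneg (φ a)]
  have hin : inner ℝ ((1 - t) • u + t • a) a = (1 - t) * inner ℝ u a + t := by
    rw [inner_add_left, real_inner_smul_left, real_inner_smul_left, haa, mul_one]
  have hinpos : 0 < (1 - t) * inner ℝ u a + t := by
    rcases ht0.lt_or_eq with h | h
    · have := mul_nonneg ht1 hpos.le; linarith
    · rw [← h]; simpa using hpos
  have hw : (1 - t) • u + t • a ∈ cone a l := by
    simp only [cone, mem_ofPred_eq] at hu ⊢
    rw [hin, abs_of_pos hinpos]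
    rw [abs_of_pos hpos] at hu
    have h1 : ‖(1 - t) • u + t • a‖ ≤ (1 - t) * ‖u‖ + t := by
      refine (norm_add_le _ _).trans ?_
      rw [norm_smul, norm_smul, ha, Real.norm_of_nonneg ht0, Real.norm_of_nonneg ht1, mul_one]
    have h2 := mul_le_mul_of_nonneg_left h1 hl.1.le
    have h3 := mul_le_mul_of_nonneg_left hu ht1
    have h4 : l * t ≤ t := mul_le_of_le_one_left ht0 hl.2.le
    linarith
  refine hφ _ hw ?_ ?_
  · intro h; rw [h, inner_zero_left] at hin; linarith
  · simp only [map_add, map_smul, smul_eq_mul, ht]; field_simp; ring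

/-- The coordinate functionals. -/
noncomputable abbrev coord (i : Fin 2) : Plane →L[ℝ] ℝ := EuclideanSpace.proj i

/-- `DG` maps the cones of `C` into each other and expands them by the factor `lam`, and all of
these cones lie in a cone around the `i`-th coordinate axis with coefficient `c`. -/
structure ExpandsCones (G : PlaneDiffeo) (lam : ℝ) (C : ConeField) (i : Fin 2) (c : ℝ) :
    Prop where
  one_lt : 1 < lam
  pos : 0 < c
  le_coord : ∀ P, ∀ u ∈ C.at P, c * ‖u‖ ≤ |u i|
  map : ∀ P, ∀ u ∈ C.at P, fderiv ℝ G P u ∈ C.at (G P)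
  expand : ∀ P, ∀ u ∈ C.at P, lam * ‖u‖ ≤ ‖fderiv ℝ G P u‖

/-- `DG` preserves (`τ = 1`) or reverses (`τ = -1`) the sign of the `i`-th coordinate on the
cones of `C`. -/
def HasSign (G : PlaneDiffeo) (C : ConeField) (i : Fin 2) (τ : ℝ) : Prop :=
  ∀ P, ∀ u ∈ C.at P, u ≠ 0 → 0 < τ * (u i * fderiv ℝ G P u i)

namespace ExpandsCones

variable {G : PlaneDiffeo} {lam : ℝ} {C : ConeField} {i : Fin 2} {c : ℝ}

theorem coord_ne_zero (S : ExpandsCones G lam C i c) {P u : Plane} (hu : u ∈ C.at P)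
    (hu0 : u ≠ 0) : u i ≠ 0 := by
  intro h
  have := S.le_coord P u hu
  rw [h, abs_zero] at this
  linarith [mul_pos S.pos (norm_pos_iff.2 hu0)]

theorem fderiv_ne_zero (S : ExpandsCones G lam C i c) {P u : Plane} (hu : u ∈ C.at P)
    (hu0 : u ≠ 0) : fderiv ℝ G P u ≠ 0 := by
  intro h
  have := S.expand P u hu
  rw [h, norm_zero] at this
  linarith [mul_pos (zero_lt_one.trans S.one_lt) (norm_pos_iff.2 hu0)]

/-- On the axis field the product of the coordinates before and after `DG` is continuous and never
zero, so it has one sign on the connected plane. Comparison with the axis carries that sign to the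
rest of each cone. -/
theorem exists_hasSign (S : ExpandsCones G lam C i c) :
    ∃ τ : ℝ, (τ = 1 ∨ τ = -1) ∧ HasSign G C i τ := by
  set f : Plane → ℝ := fun P => C.axis P i * fderiv ℝ G P (C.axis P) i with hf
  have hfc : Continuous f := by
    have h1 : Continuous fun P => fderiv ℝ G P (C.axis P) :=
      (G.contDiff.continuous_fderiv one_ne_zero).clm_apply C.continuous_axis
    have h2 := C.continuous_axis
    exact ((coord i).continuous.comp h2).mul ((coord i).continuous.comp h1)
  have hf0 : ∀ P, f P ≠ 0 := fun P => mul_ne_zero (S.coord_ne_zero (C.axis_mem P) (C.axis_ne_zero P))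
    (S.coord_ne_zero (S.map P _ (C.axis_mem P)) (S.fderiv_ne_zero (C.axis_mem P) (C.axis_ne_zero P)))
  -- The sign relations for the coordinate and for its pullback by `DG` share the factor `inner ℝ u
  -- (C.axis P)`, which becomes a square in their product.
  have key : ∀ P, ∀ u ∈ C.at P, u ≠ 0 → 0 < f P * (u i * fderiv ℝ G P u i) := by
    intro P u hu hu0
    have h1 := inner_mul_pos_of_ne_zero_on_cone (C.norm_axis P) (C.coeff_mem P) (coord i)
      (fun u hu hu0 => S.coord_ne_zero hu hu0) hu hu0
    have h2 := inner_mul_pos_of_ne_zero_on_cone (C.norm_axis P) (C.coeff_mem P)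
      ((coord i).comp (fderiv ℝ G P))
      (fun u hu hu0 => S.coord_ne_zero (S.map P u hu) (S.fderiv_ne_zero hu hu0)) hu hu0
    have h3 := mul_pos h1 h2
    simp only [ContinuousLinearMap.comp_apply, coord, PiLp.proj_apply] at h3
    have h4 : 0 < (inner ℝ u (C.axis P)) ^ 2 * (f P * (u i * fderiv ℝ G P u i)) := by
      simp only [hf]; linarith
    exact pos_of_mul_pos_right h4 (sq_nonneg _)
  have hsame : ∀ P Q, 0 < f P → 0 < f Q := by
    intro P Q hP
    by_contra hQ
    obtain ⟨R, hR⟩ := mem_range_of_exists_le_of_exists_ge hfc ⟨Q, not_lt.1 hQ⟩ ⟨P, hP.le⟩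
    exact hf0 R hR
  by_cases h : 0 < f 0
  · refine ⟨1, Or.inl rfl, fun P u hu hu0 => ?_⟩
    rw [one_mul]
    exact pos_of_mul_pos_right (key P u hu hu0) (hsame 0 P h).le
  · refine ⟨-1, Or.inr rfl, fun P u hu hu0 => ?_⟩
    have hP : f P < 0 := lt_of_le_of_ne (not_lt.1 fun h' => h (hsame P 0 h')) (hf0 P)
    have := key P u hu hu0
    nlinarith

end ExpandsCones

/-! ### Arcs tangent to a cone-field -/

/-- `γ` is an arc on `[a, b]` with right derivative `v`, tangent to the cone-field `C` and with
monotone `i`-th coordinate, increasing or decreasing according to the sign of `s`. -/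
structure IsArc (C : ConeField) (i : Fin 2) (s a b : ℝ) (γ v : ℝ → Plane) : Prop where
  cont : ContinuousOn γ (Icc a b)
  deriv : ∀ t ∈ Ico a b, HasDerivWithinAt γ (v t) (Ici t) t
  mem : ∀ t ∈ Ico a b, v t ∈ C.at (γ t)
  pos : ∀ t ∈ Ico a b, 0 < s * v t i

/-- Mean value inequality along an arc. -/
theorem IsArc.norm_sub_le {C : ConeField} {i : Fin 2} {s a b c K : ℝ} {γ v : ℝ → Plane}
    (h : IsArc C i s a b γ v) (hs : |s| = 1) (hc : 0 < c)
    (hC : ∀ P, ∀ u ∈ C.at P, c * ‖u‖ ≤ |u i|)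
    {E : Type*} [NormedAddCommGroup E] [NormedSpace ℝ E] {f f' : ℝ → E} (hK : 0 ≤ K)
    (hf : ContinuousOn f (Icc a b)) (hf' : ∀ t ∈ Ico a b, HasDerivWithinAt f (f' t) (Ici t) t)
    (hle : ∀ t ∈ Ico a b, K * ‖f' t‖ ≤ ‖v t‖) {t t' : ℝ} (ht : t ∈ Icc a b) (ht' : t' ∈ Icc a b)
    (htt : t ≤ t') : c * K * ‖f t' - f t‖ ≤ s * (γ t' i - γ t i) := by
  have hsub : Icc t t' ⊆ Icc a b := Icc_subset_Icc ht.1 ht'.2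
  have hsub' : Ico t t' ⊆ Ico a b := Ico_subset_Ico ht.1 ht'.2
  have hγ : ContinuousOn (fun x => γ x i) (Icc a b) := (coord i).continuous.comp_continuousOn h.cont
  -- The comparison function is the oriented coordinate, whose right derivative is at least `c * ‖v
  -- x‖` by the cone bound.
  have := image_norm_le_of_norm_deriv_right_le_deriv_boundary' (a := t) (b := t')
    (f := fun x => (c * K) • (f x - f t)) (f' := fun x => (c * K) • f' x)
    (B := fun x => s * (γ x i - γ t i)) (B' := fun x => s * v x i)
    (((hf.mono hsub).sub continuousOn_const).const_smul _)
    (fun x hx => ((hf' x (hsub' hx)).sub_const _).const_smul _) (by simp)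
    (continuousOn_const.mul ((hγ.mono hsub).sub continuousOn_const))
    (fun x hx => (((coord i).hasFDerivAt.comp_hasDerivWithinAt x
      (h.deriv x (hsub' hx))).sub_const _).const_mul s)
    (fun x hx => by
      rw [norm_smul, Real.norm_of_nonneg (by positivity), mul_assoc]
      refine (mul_le_mul_of_nonneg_left (hle x (hsub' hx)) hc.le).trans ?_
      refine (hC _ _ (h.mem x (hsub' hx))).trans ?_
      rw [← abs_of_pos (h.pos x (hsub' hx)), abs_mul, hs, one_mul]) (right_mem_Icc.2 htt)
  simpa only [norm_smul, Real.norm_of_nonneg (show 0 ≤ c * K by positivity)] using this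

/-- Chords of an arc. -/
theorem IsArc.chord_le {C : ConeField} {i : Fin 2} {s a b c : ℝ} {γ v : ℝ → Plane}
    (h : IsArc C i s a b γ v) (hs : |s| = 1) (hc : 0 < c)
    (hC : ∀ P, ∀ u ∈ C.at P, c * ‖u‖ ≤ |u i|) {t t' : ℝ} (ht : t ∈ Icc a b) (ht' : t' ∈ Icc a b)
    (htt : t ≤ t') : c * ‖γ t' - γ t‖ ≤ s * (γ t' i - γ t i) := by
  simpa using h.norm_sub_le hs hc hC zero_le_one h.cont h.deriv (by simp) ht ht' htt

/-- An arc that is traversed with speed at least `m` covers at least `c * m * (t' - t)` of the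
coordinate axis. -/
theorem IsArc.growth {C : ConeField} {i : Fin 2} {s a b c m : ℝ} {γ v : ℝ → Plane}
    (h : IsArc C i s a b γ v) (hs : |s| = 1) (hc : 0 < c)
    (hC : ∀ P, ∀ u ∈ C.at P, c * ‖u‖ ≤ |u i|) (hm : 0 ≤ m) (hv : ∀ t ∈ Ico a b, m ≤ ‖v t‖)
    {t t' : ℝ} (ht : t ∈ Icc a b) (ht' : t' ∈ Icc a b)
    (htt : t ≤ t') : c * m * (t' - t) ≤ s * (γ t' i - γ t i) := by
  have := h.norm_sub_le hs hc hC hm (f := fun x => x) (f' := fun _ => (1 : ℝ)) continuousOn_id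
    (fun x _ => hasDerivWithinAt_id _ _) (by simpa using hv) ht ht' htt
  rwa [Real.norm_of_nonneg (sub_nonneg.2 htt)] at this

theorem IsArc.mono {C : ConeField} {i : Fin 2} {s a b a' b' : ℝ} {γ v : ℝ → Plane}
    (h : IsArc C i s a b γ v) (ha : a ≤ a') (hb : b' ≤ b) : IsArc C i s a' b' γ v :=
  ⟨h.cont.mono (Icc_subset_Icc ha hb), fun t ht => h.deriv t (Ico_subset_Ico ha hb ht),
    fun t ht => h.mem t (Ico_subset_Ico ha hb ht), fun t ht => h.pos t (Ico_subset_Ico ha hb ht)⟩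

/-- Through each point there are short arcs in both directions. -/
theorem ConeField.exists_isArc (C : ConeField) (i : Fin 2) {s : ℝ} (hs : s = 1 ∨ s = -1)
    {P : Plane} (hP : C.axis P i ≠ 0) {U : Set Plane} (hU : U ∈ nhds P) :
    ∃ γ v : ℝ → Plane, ∃ m > 0, IsArc C i s (-1) 1 γ v ∧ γ 0 = P ∧
      (∀ t ∈ Icc (-1 : ℝ) 1, γ t ∈ U) ∧ ∀ t, m ≤ ‖v t‖ := by
  obtain ⟨r, hr, hr0⟩ : ∃ r : ℝ, |r| = 1 ∧ 0 < s * (r * C.axis P i) := by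
    rcases hP.lt_or_gt with h | h <;> rcases hs with rfl | rfl
    · exact ⟨-1, by simp, by linarith⟩
    · exact ⟨1, by simp, by linarith⟩
    · exact ⟨1, by simp, by linarith⟩
    · exact ⟨-1, by simp, by linarith⟩
  -- As the coefficient is below 1, the axis at `P` is interior to its cone and stays in the cones
  -- at nearby points, so a straight segment serves as the arc.
  have hV : {Q | C.axis P ∈ C.at Q} ∈ nhds P := by
    have hc : Continuous fun Q => |inner ℝ (C.axis P) (C.axis Q)| - C.coeff Q * ‖C.axis P‖ := by
      have := C.continuous_axis
      have := C.continuous_coeff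
      fun_prop
    have h0 : 0 < |inner ℝ (C.axis P) (C.axis P)| - C.coeff P * ‖C.axis P‖ := by
      rw [real_inner_self_eq_norm_sq, C.norm_axis]
      have := (C.coeff_mem P).2
      simp; linarith
    filter_upwards [hc.continuousAt.eventually (lt_mem_nhds h0)] with Q hQ
    exact (sub_pos.1 hQ).le
  obtain ⟨ε, hε, hball⟩ := Metric.mem_nhds_iff.1 (Filter.inter_mem hU hV)
  have hin : ∀ t ∈ Icc (-1 : ℝ) 1, P + (t * (ε / 2 * r)) • C.axis P ∈ U ∩ {Q | C.axis P ∈ C.at Q} := by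
    intro t ht
    apply hball
    rw [mem_ball_iff_norm, add_sub_cancel_left, norm_smul, C.norm_axis, mul_one, norm_mul, norm_mul,
      Real.norm_eq_abs r, hr, mul_one, Real.norm_of_nonneg (by positivity : 0 ≤ ε / 2)]
    have : ‖t‖ ≤ 1 := abs_le.2 ht
    nlinarith [norm_nonneg t]
  refine ⟨fun t => P + (t * (ε / 2 * r)) • C.axis P, fun _ => (ε / 2 * r) • C.axis P, ε / 2,
    by positivity, ⟨by fun_prop, fun t ht => ?_, fun t ht => ?_, fun t ht => ?_⟩, by simp,
    fun t ht => (hin t ht).1, fun t => ?_⟩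
  · have := (((hasDerivAt_id t).mul_const (ε / 2 * r)).smul_const (C.axis P)).const_add P
    simpa using this.hasDerivWithinAt
  · exact C.smul_mem _ (hin t ⟨ht.1, ht.2.le⟩).2
  · simp only [PiLp.smul_apply, smul_eq_mul]
    have := mul_pos (half_pos hε) hr0
    linarith
  · rw [norm_smul, C.norm_axis, norm_mul, Real.norm_eq_abs r, hr, Real.norm_of_nonneg (by positivity)]
    simp

/-- `Φ` maps arcs to arcs, expanding them by the factor `lam`. -/
def MapsArcs (Φ : Plane → Plane) (lam : ℝ) (C : ConeField) (i : Fin 2) (τ : ℝ) : Prop :=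
  ∀ (s a b : ℝ) (γ v : ℝ → Plane), IsArc C i s a b γ v →
    ∃ w, IsArc C i (τ * s) a b (Φ ∘ γ) w ∧ ∀ t ∈ Ico a b, lam * ‖v t‖ ≤ ‖w t‖

theorem MapsArcs.iterate {Φ : Plane → Plane} {lam : ℝ} {C : ConeField} {i : Fin 2} {τ : ℝ}
    (h : MapsArcs Φ lam C i τ) (hlam : 1 < lam) (n : ℕ) : MapsArcs Φ^[n] (lam ^ n) C i (τ ^ n) := by
  induction n with
  | zero => intro s a b γ v hγ; exact ⟨v, by simpa using hγ, by simp⟩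
  | succ n ih =>
    intro s a b γ v hγ
    obtain ⟨w, hw, hwn⟩ := ih s a b γ v hγ
    obtain ⟨z, hz, hzn⟩ := h _ a b _ w hw
    refine ⟨z, ?_, fun t ht => ?_⟩
    · rw [Function.iterate_succ', pow_succ', mul_assoc]; exact hz
    · refine le_trans ?_ (hzn t ht)
      rw [pow_succ', mul_assoc]
      exact mul_le_mul_of_nonneg_left (hwn t ht) (by linarith)

theorem abs_pow_mul_eq_one {τ s : ℝ} (hτ : |τ| = 1) (hs : |s| = 1) (n : ℕ) :
    |τ ^ n * s| = 1 := by rw [abs_mul, abs_pow, hτ, hs]; simp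

/-- The iterates of an arc cannot all stay in a bounded set. -/
theorem MapsArcs.not_bounded {Φ : Plane → Plane} {lam : ℝ} {C : ConeField} {i : Fin 2} {τ : ℝ}
    (h : MapsArcs Φ lam C i τ) (hlam : 1 < lam) (hτ : |τ| = 1) {c : ℝ} (hc : 0 < c)
    (hC : ∀ P, ∀ u ∈ C.at P, c * ‖u‖ ≤ |u i|) {s a b m : ℝ} (hs : |s| = 1) (hab : a < b)
    (hm : 0 < m) {γ v : ℝ → Plane} (hγ : IsArc C i s a b γ v) (hv : ∀ t ∈ Ico a b, m ≤ ‖v t‖)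
    {S : Set Plane} (hS : Bornology.IsBounded S) :
    ¬ ∀ n, ∀ t ∈ Icc a b, Φ^[n] (γ t) ∈ S := by
  intro hmem
  obtain ⟨M, hM⟩ := hS.exists_norm_le
  -- The coordinate extent of the `n`-th image grows at least like `lam ^ n`, while boundedness caps
  -- it at `2 * M`.
  have hbd : ∀ n : ℕ, c * m * (b - a) * lam ^ n ≤ 2 * M := by
    intro n
    obtain ⟨w, hw, hwn⟩ := h.iterate hlam n s a b γ v hγ
    have hln : 0 < lam ^ n := by positivity
    have h1 := hw.growth (abs_pow_mul_eq_one hτ hs n) hc hC (m := lam ^ n * m) (by positivity)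
      (fun t ht => (mul_le_mul_of_nonneg_left (hv t ht) hln.le).trans (hwn t ht))
      (left_mem_Icc.2 hab.le) (right_mem_Icc.2 hab.le) hab.le
    have hcoord : ∀ t ∈ Icc a b, |(Φ^[n] ∘ γ) t i| ≤ M := fun t ht =>
      (PiLp.norm_apply_le (Φ^[n] (γ t)) i).trans (hM _ (hmem n t ht))
    have h2 := hcoord _ (left_mem_Icc.2 hab.le)
    have h3 := hcoord _ (right_mem_Icc.2 hab.le)
    have h4 : τ ^ n * s * ((Φ^[n] ∘ γ) b i - (Φ^[n] ∘ γ) a i) ≤ 2 * M := by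
      refine (le_abs_self _).trans ?_
      rw [abs_mul, abs_pow_mul_eq_one hτ hs n, one_mul]
      refine (abs_sub _ _).trans ?_
      linarith
    linarith
  have hk : 0 < c * m * (b - a) := by have := sub_pos.2 hab; positivity
  obtain ⟨n, hn⟩ := pow_unbounded_of_one_lt (2 * M / (c * m * (b - a))) hlam
  rw [div_lt_iff₀ hk] at hn
  linarith [hbd n]

theorem ExpandsCones.isArc_comp {G : PlaneDiffeo} {lam : ℝ} {C : ConeField} {i : Fin 2} {c τ : ℝ}
    (S : ExpandsCones G lam C i c) (hτ : HasSign G C i τ) {s a b : ℝ} {γ v : ℝ → Plane}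
    (h : IsArc C i s a b γ v) :
    IsArc C i (τ * s) a b (G ∘ γ) (fun t => fderiv ℝ G (γ t) (v t)) := by
  refine ⟨G.contDiff.continuous.comp_continuousOn h.cont,
    fun t ht => (G.hasFDerivAt (γ t)).comp_hasDerivWithinAt t (h.deriv t ht),
    fun t ht => S.map _ _ (h.mem t ht), fun t ht => ?_⟩
  have h1 := h.pos t ht
  have h0 : v t ≠ 0 := by rintro h0; simp [h0] at h1
  have h2 := mul_pos h1 (hτ _ _ (h.mem t ht) h0)
  have h3 : 0 < (v t i) ^ 2 * (τ * s * fderiv ℝ G (γ t) (v t) i) := by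
    linarith
  exact pos_of_mul_pos_right h3 (sq_nonneg _)

theorem ExpandsCones.mapsArcs {G : PlaneDiffeo} {lam : ℝ} {C : ConeField} {i : Fin 2} {c τ : ℝ}
    (S : ExpandsCones G lam C i c) (hτ : HasSign G C i τ) : MapsArcs G lam C i τ :=
  fun _ _ _ _ _ h => ⟨_, S.isArc_comp hτ h, fun t ht => S.expand _ _ (h.mem t ht)⟩

/-! ### The universal cones and the divider -/

theorem plane_eta (P : Plane) : !₂[P 0, P 1] = P := by
  ext i; fin_cases i <;> rfl

theorem norm_sq_plane (u : Plane) : ‖u‖ ^ 2 = u 0 ^ 2 + u 1 ^ 2 := by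
  simp [EuclideanSpace.norm_sq_eq, Fin.sum_univ_two]

theorem mem_cone_fst {u : Plane} {l : ℝ} : u ∈ cone !₂[1, 0] l ↔ l * ‖u‖ ≤ |u 0| := by
  simp [cone, PiLp.inner_apply, Fin.sum_univ_two]

theorem mem_cone_snd {u : Plane} {l : ℝ} : u ∈ cone !₂[0, 1] l ↔ l * ‖u‖ ≤ |u 1| := by
  simp [cone, PiLp.inner_apply, Fin.sum_univ_two]

theorem abs_le_of_mul_norm_le {l x y n : ℝ} (hl : l ∈ Ioo (0 : ℝ) 1) (hn : 0 ≤ n)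
    (hxy : n ^ 2 = x ^ 2 + y ^ 2) (h : l * n ≤ |x|) : |y| ≤ √(1 - l ^ 2) / l * |x| := by
  have h1 : l ^ 2 * (x ^ 2 + y ^ 2) ≤ x ^ 2 := by
    rw [← hxy, ← mul_pow, ← sq_abs x]
    exact pow_le_pow_left₀ (mul_nonneg hl.1.le hn) h 2
  have h2 : 0 ≤ 1 - l ^ 2 := by nlinarith [hl.1, hl.2]
  rw [div_mul_eq_mul_div, le_div_iff₀ hl.1]
  have h3 : |y * l| ≤ |√(1 - l ^ 2) * x| := by
    apply sq_le_sq.1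
    rw [mul_pow, mul_pow, Real.sq_sqrt h2]
    linarith
  rwa [abs_mul, abs_mul, abs_of_pos hl.1, abs_of_nonneg (Real.sqrt_nonneg _)] at h3

/-- Otherwise a unit vector on the boundary of the stable cone would also lie in the unstable one.
-/
theorem UniversalPair.one_lt (K : UniversalPair) : 1 < K.coeffU ^ 2 + K.coeffS ^ 2 := by
  by_contra! h
  have hu := K.coeffU_mem
  have hs := K.coeffS_mem
  have h2 : 0 ≤ 1 - K.coeffS ^ 2 := by nlinarith [sq_nonneg K.coeffU]
  set u : Plane := !₂[√(1 - K.coeffS ^ 2), K.coeffS] with hu_def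
  have hn : ‖u‖ = 1 := by
    have : ‖u‖ ^ 2 = 1 := by rw [norm_sq_plane]; simp [hu_def, Real.sq_sqrt h2]
    have h0 := norm_nonneg u
    nlinarith
  have h3 : u ∈ cone !₂[1, 0] K.coeffU ∩ cone !₂[0, 1] K.coeffS := by
    refine ⟨mem_cone_fst.2 ?_, mem_cone_snd.2 ?_⟩
    · rw [hn, mul_one]
      refine le_trans ?_ (le_abs_self _)
      exact Real.le_sqrt_of_sq_le (by linarith)
    · rw [hn, mul_one]
      exact le_abs_self _
  rw [K.disjoint] at h3
  rw [mem_singleton_iff.1 h3, norm_zero] at hn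
  exact zero_ne_one hn

/-- The universal cones are bounded by lines whose slopes have product less than one. -/
theorem UniversalPair.exists_slopes (K : UniversalPair) : ∃ α β : ℝ, 0 ≤ α ∧ 0 ≤ β ∧ α * β < 1 ∧
    (∀ u ∈ K.Ku, |u 1| ≤ α * |u 0|) ∧ ∀ w ∈ K.Ks, |w 0| ≤ β * |w 1| := by
  have hu := K.coeffU_mem
  have hs := K.coeffS_mem
  refine ⟨√(1 - K.coeffU ^ 2) / K.coeffU, √(1 - K.coeffS ^ 2) / K.coeffS,
    div_nonneg (Real.sqrt_nonneg _) hu.1.le, div_nonneg (Real.sqrt_nonneg _) hs.1.le, ?_, ?_, ?_⟩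
  · have h1 : 0 ≤ 1 - K.coeffU ^ 2 := by nlinarith [hu.1, hu.2]
    rw [div_mul_div_comm, div_lt_one (mul_pos hu.1 hs.1), ← Real.sqrt_mul h1,
      Real.sqrt_lt' (mul_pos hu.1 hs.1)]
    nlinarith [K.one_lt]
  · intro u h
    exact abs_le_of_mul_norm_le hu (norm_nonneg u) (norm_sq_plane u) (mem_cone_fst.1 h)
  · intro u h
    exact abs_le_of_mul_norm_le hs (norm_nonneg u) (by rw [norm_sq_plane, add_comm])
      (mem_cone_snd.1 h)

namespace SynchronouslyHyperbolic

variable {F₁ F₂ : PlaneDiffeo} (H : SynchronouslyHyperbolic F₁ F₂)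

theorem le_coord_unstable (P : Plane) (u : Plane) (hu : u ∈ H.Cu.at P) :
    H.K.coeffU * ‖u‖ ≤ |u 0| := mem_cone_fst.1 (H.unstable_subset P hu)

theorem le_coord_stable (P : Plane) (u : Plane) (hu : u ∈ H.Cs.at P) :
    H.K.coeffS * ‖u‖ ≤ |u 1| := mem_cone_snd.1 (H.stable_subset P hu)

theorem expandsCones {G : PlaneDiffeo} (hG : HyperbolicFor G H.lam H.Cu H.Cs) :
    ExpandsCones G H.lam H.Cu 0 H.K.coeffU :=
  ⟨H.one_lt_lam, H.K.coeffU_mem.1, H.le_coord_unstable, hG.map_unstable, hG.expand_unstable⟩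

theorem expandsCones_symm {G : PlaneDiffeo} (hG : HyperbolicFor G H.lam H.Cu H.Cs) :
    ExpandsCones G.symm H.lam H.Cs 1 H.K.coeffS :=
  ⟨H.one_lt_lam, H.K.coeffS_mem.1, H.le_coord_stable, hG.map_stable, hG.expand_stable⟩

theorem eq_of_mem_divider {P : Plane} (hP : P 0 = H.g (P 1)) : F₁ P = F₂ P := by
  have := H.agree (P 1)
  rwa [← hP, plane_eta] at this

theorem map_of_le {P : Plane} (hP : P 0 ≤ H.g (P 1)) : H.map P = F₁ P := if_pos hP

theorem map_of_ge {P : Plane} (hP : H.g (P 1) ≤ P 0) : H.map P = F₂ P := by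
  rcases hP.lt_or_eq with h | h
  · exact if_neg (not_le.2 h)
  · rw [H.map_of_le h.ge, H.eq_of_mem_divider h.symm]

theorem continuous_g : Continuous H.g := H.contDiff_g.continuous

theorem continuous_g_snd : Continuous fun P : Plane => H.g (P 1) :=
  H.continuous_g.comp (coord 1).continuous

theorem continuous_map : Continuous H.map := by
  classical
  have h0 : Continuous fun P : Plane => P 0 := (coord 0).continuous
  have := Continuous.if_le F₁.contDiff.continuous F₂.contDiff.continuous h0 H.continuous_g_snd
    (fun P hP => H.eq_of_mem_divider hP)
  have heq : H.map = fun P => if P 0 ≤ H.g (P 1) then F₁ P else F₂ P := by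
    ext1 P
    simp only [map]
  rw [heq]; exact this

theorem isOpen_left : IsOpen H.left := isOpen_lt (coord 0).continuous H.continuous_g_snd

theorem isOpen_right : IsOpen H.right := isOpen_lt H.continuous_g_snd (coord 0).continuous

theorem disjoint_left_right : Disjoint H.left H.right :=
  disjoint_left.2 fun P h1 h2 => lt_asymm (show P 0 < H.g (P 1) from h1) h2

/-- A point seen to the right, within the unstable cone, from a point of the closed right
half-plane is in the open right half-plane. -/
theorem mem_right_of_mem_cone {P Q : Plane} (hK : Q - P ∈ H.K.Ku) (hpos : P 0 < Q 0)
    (hP : H.g (P 1) ≤ P 0) : H.g (Q 1) < Q 0 := by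
  obtain ⟨α, β, hα, hβ, hαβ, hu, hs⟩ := H.K.exists_slopes
  -- The tangent condition bounds the derivative of `g` by the stable slope `β`. As `α * β < 1`, an
  -- unstable chord cannot return across the graph.
  have hlip : |H.g (Q 1) - H.g (P 1)| ≤ β * |Q 1 - P 1| := by
    have := Convex.norm_image_sub_le_of_norm_deriv_le (f := H.g) (C := β) (s := univ)
      (fun x _ => (H.contDiff_g.differentiable one_ne_zero) x) (fun x _ => by
        simpa using hs _ (H.stable_subset _ (H.tangent x))) convex_univ (mem_univ (P 1))
        (mem_univ (Q 1))
    simpa [Real.norm_eq_abs] using this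
  have h1 := hu _ hK
  simp only [PiLp.sub_apply] at h1
  rw [abs_of_pos (sub_pos.2 hpos)] at h1
  have h2 := mul_le_mul_of_nonneg_left h1 hβ
  have h3 := (le_abs_self _).trans hlip
  have h4 : 0 < (1 - α * β) * (Q 0 - P 0) := mul_pos (by linarith) (sub_pos.2 hpos)
  nlinarith

theorem mem_left_of_mem_cone {P Q : Plane} (hK : Q - P ∈ H.K.Ku) (hpos : Q 0 < P 0)
    (hP : P 0 ≤ H.g (P 1)) : Q 0 < H.g (Q 1) := by
  by_contra! h
  have hK' : P - Q ∈ H.K.Ku := by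
    have := smul_mem_cone (-1) hK
    rwa [neg_one_smul, neg_sub] at this
  exact absurd (H.mem_right_of_mem_cone hK' hpos h) (not_lt.2 hP)

/-- Serves to keep a leftward arc in the closed left half-plane once it starts there. With equal
first coordinates the chord bound forces `Q = P`. -/
theorem le_of_chord {P Q : Plane}
    (hQ : H.K.coeffU * ‖Q - P‖ ≤ (-1) * (Q 0 - P 0)) (hP : P 0 ≤ H.g (P 1)) : Q 0 ≤ H.g (Q 1) := by
  rcases (show Q 0 ≤ P 0 by
    have := mul_nonneg H.K.coeffU_mem.1.le (norm_nonneg (Q - P)); linarith).lt_or_eq with h1 | h1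
  · refine (H.mem_left_of_mem_cone (mem_cone_fst.2 (hQ.trans ?_)) h1 hP).le
    rw [PiLp.sub_apply, abs_of_neg (sub_neg.2 h1)]; linarith
  · have h2 : ‖Q - P‖ ≤ 0 := by
      rw [h1, sub_self, mul_zero] at hQ
      exact nonpos_of_mul_nonpos_right hQ H.K.coeffU_mem.1
    rw [sub_eq_zero.1 (norm_le_zero_iff.1 h2)]; exact hP

theorem ge_of_chord {P Q : Plane}
    (hQ : H.K.coeffU * ‖Q - P‖ ≤ 1 * (Q 0 - P 0)) (hP : H.g (P 1) ≤ P 0) : H.g (Q 1) ≤ Q 0 := by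
  rcases (show P 0 ≤ Q 0 by
    have := mul_nonneg H.K.coeffU_mem.1.le (norm_nonneg (Q - P)); linarith).lt_or_eq with h1 | h1
  · refine (H.mem_right_of_mem_cone (mem_cone_fst.2 (hQ.trans ?_)) h1 hP).le
    rw [PiLp.sub_apply, abs_of_pos (sub_pos.2 h1)]; linarith
  · have h2 : ‖Q - P‖ ≤ 0 := by
      rw [← h1, sub_self, mul_zero] at hQ
      exact nonpos_of_mul_nonpos_right hQ H.K.coeffU_mem.1
    rw [sub_eq_zero.1 (norm_le_zero_iff.1 h2)]; exact hP

/-- Following an unstable arc, the map `H.map` locally coincides with `F₁` or with `F₂`. -/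
theorem map_eventuallyEq_of_isArc {s a b : ℝ} {γ v : ℝ → Plane} (h : IsArc H.Cu 0 s a b γ v)
    {t : ℝ} (ht : t ∈ Ico a b) :
    (H.map ∘ γ =ᶠ[nhdsWithin t (Ici t)] F₁ ∘ γ) ∨ (H.map ∘ γ =ᶠ[nhdsWithin t (Ici t)] F₂ ∘ γ) := by
  have hc : ContinuousWithinAt γ (Ici t) t := (h.deriv t ht).continuousWithinAt
  have hIco : Ico t b ∈ nhdsWithin t (Ici t) := Ico_mem_nhdsGE ht.2
  have hsub : ∀ t' ∈ Ico t b, t' ∈ Icc a b := fun t' h' => ⟨ht.1.trans h'.1, h'.2.le⟩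
  have hs0 := h.pos t ht
  rcases lt_trichotomy (γ t 0) (H.g (γ t 1)) with hlt | heq | hgt
  · left
    filter_upwards [hc.eventually (H.isOpen_left.mem_nhds hlt)] with t' ht'
    exact H.map_of_le (le_of_lt ht')
  -- On the divider the direction of travel, given by the sign of `s`, decides which half-plane is
  -- entered. Only later times count for a right derivative.
  · rcases lt_or_gt_of_ne (show s ≠ 0 by rintro rfl; simp at hs0) with hs | hs
    · left
      have h' : IsArc H.Cu 0 (-1) a b γ v := ⟨h.cont, h.deriv, h.mem, fun t ht => by
        have := h.pos t ht; nlinarith⟩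
      filter_upwards [hIco] with t' ht'
      exact H.map_of_le (H.le_of_chord (h'.chord_le (by simp) H.K.coeffU_mem.1
        H.le_coord_unstable ⟨ht.1, ht.2.le⟩ (hsub t' ht') ht'.1) heq.le)
    · right
      have h' : IsArc H.Cu 0 1 a b γ v := ⟨h.cont, h.deriv, h.mem, fun t ht => by
        have := h.pos t ht; nlinarith⟩
      filter_upwards [hIco] with t' ht'
      exact H.map_of_ge (H.ge_of_chord (h'.chord_le (by simp) H.K.coeffU_mem.1
        H.le_coord_unstable ⟨ht.1, ht.2.le⟩ (hsub t' ht') ht'.1) heq.ge)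
  · right
    filter_upwards [hc.eventually (H.isOpen_right.mem_nhds hgt)] with t' ht'
    exact H.map_of_ge (le_of_lt ht')

/-- If `F₁` and `F₂` act in the same way on the orientation of the unstable cones, then `H.map`
maps unstable arcs to unstable arcs. -/
theorem mapsArcs_map {τ : ℝ} (h₁ : HasSign F₁ H.Cu 0 τ) (h₂ : HasSign F₂ H.Cu 0 τ) :
    MapsArcs H.map H.lam H.Cu 0 τ := by
  intro s a b γ v h
  have hcomp : ∀ (G : PlaneDiffeo), HasSign G H.Cu 0 τ → HyperbolicFor G H.lam H.Cu H.Cs →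
      ∀ t ∈ Ico a b, H.map ∘ γ =ᶠ[nhdsWithin t (Ici t)] G ∘ γ →
      ∃ w, HasDerivWithinAt (H.map ∘ γ) w (Ici t) t ∧ w ∈ H.Cu.at ((H.map ∘ γ) t) ∧
        0 < τ * s * w 0 ∧ H.lam * ‖v t‖ ≤ ‖w‖ := by
    intro G hG hyp t ht heq
    have hG' := (H.expandsCones hyp).isArc_comp hG h
    refine ⟨fderiv ℝ G (γ t) (v t), (hG'.deriv t ht).congr_of_eventuallyEq_of_mem heq
      self_mem_Ici, ?_, hG'.pos t ht, hyp.expand_unstable _ _ (h.mem t ht)⟩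
    rw [heq.self_of_nhdsWithin self_mem_Ici]
    exact hG'.mem t ht
  have hex : ∀ t ∈ Ico a b, ∃ w, HasDerivWithinAt (H.map ∘ γ) w (Ici t) t ∧
      w ∈ H.Cu.at ((H.map ∘ γ) t) ∧ 0 < τ * s * w 0 ∧ H.lam * ‖v t‖ ≤ ‖w‖ := by
    intro t ht
    rcases H.map_eventuallyEq_of_isArc h ht with h' | h'
    · exact hcomp F₁ h₁ H.hyperbolic₁ t ht h'
    · exact hcomp F₂ h₂ H.hyperbolic₂ t ht h'
  choose! w hw using hex
  exact ⟨w, ⟨H.continuous_map.comp_continuousOn h.cont, fun t ht => (hw t ht).1,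
    fun t ht => (hw t ht).2.1, fun t ht => (hw t ht).2.2.1⟩, fun t ht => (hw t ht).2.2.2⟩

end SynchronouslyHyperbolic

/-! ### Trapping regions -/

theorem IsDiskTrappingRegion.isBounded {F : Plane → Plane} {D : Set Plane}
    (hD : IsDiskTrappingRegion F D) : Bornology.IsBounded D := by
  obtain ⟨e⟩ := hD.closedDisk
  have : CompactSpace (Metric.closedBall (0 : Plane) 1) :=
    isCompact_iff_compactSpace.1 (isCompact_closedBall _ _)
  have hc : CompactSpace (closure D) := e.symm.compactSpace
  exact (isCompact_iff_compactSpace.2 hc).isBounded.subset subset_closure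

theorem IsDiskTrappingRegion.isPreconnected {F : Plane → Plane} {D : Set Plane}
    (hD : IsDiskTrappingRegion F D) : IsPreconnected D := by
  obtain ⟨e⟩ := hD.openDisk
  have : PreconnectedSpace (Metric.ball (0 : Plane) 1) :=
    isPreconnected_iff_preconnectedSpace.1 (convex_ball _ _).isPreconnected
  have hc : PreconnectedSpace D := e.symm.surjective.denseRange.preconnectedSpace e.symm.continuous
  exact isPreconnected_iff_preconnectedSpace.2 hc

theorem IsTrappingRegion.map_mem_interior {F : Plane → Plane} {D : Set Plane}
    (hD : IsTrappingRegion F D) {P : Plane} (hP : P ∈ D) : F P ∈ interior D :=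
  hD.2 (mem_image_of_mem F (subset_closure hP))

theorem IsTrappingRegion.map_mem {F : Plane → Plane} {D : Set Plane}
    (hD : IsTrappingRegion F D) {P : Plane} (hP : P ∈ D) : F P ∈ D :=
  interior_subset (hD.map_mem_interior hP)

/-- A map that expands arcs does not map a bounded set with nonempty interior into itself. -/
theorem MapsArcs.not_mapsTo {Φ : Plane → Plane} {lam : ℝ} {C : ConeField} {i : Fin 2} {τ c : ℝ}
    (h : MapsArcs Φ lam C i τ) (hlam : 1 < lam) (hτ : |τ| = 1) (hc : 0 < c)
    (hC : ∀ P, ∀ u ∈ C.at P, c * ‖u‖ ≤ |u i|) {S : Set Plane} (hS : Bornology.IsBounded S)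
    (hne : (interior S).Nonempty) : ¬ MapsTo Φ S S := by
  intro hm
  obtain ⟨P, hP⟩ := hne
  have hax : C.axis P i ≠ 0 := by
    intro h0
    have := hC P _ (C.axis_mem P)
    rw [h0, C.norm_axis, abs_zero] at this
    linarith
  obtain ⟨γ, v, m, hm0, hγ, -, hγU, hv⟩ := C.exists_isArc i (Or.inl rfl) hax
    (isOpen_interior.mem_nhds hP)
  exact h.not_bounded hlam hτ hc hC (by simp) (by norm_num) hm0 hγ (fun t _ => hv t) hS
    fun n t ht => hm.iterate n (interior_subset (hγU t ht))

theorem IsTrappingRegion.interior_nonempty {F : Plane → Plane} {D : Set Plane}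
    (hD : IsTrappingRegion F D) : (interior D).Nonempty := by
  obtain ⟨P, hP⟩ := hD.1
  exact ⟨_, hD.map_mem_interior hP⟩

theorem abs_eq_one_of_sign {τ : ℝ} (h : τ = 1 ∨ τ = -1) : |τ| = 1 := by
  rcases h with rfl | rfl <;> simp

/-- The half of an unstable arc that starts at a fixed point in the direction `s` cannot stay
in a region in which `G` maps a bounded set into itself. -/
theorem ExpandsCones.not_fixedPoint {G : PlaneDiffeo} {lam : ℝ} {C : ConeField} {i : Fin 2}
    {c : ℝ} (S : ExpandsCones G lam C i c) (hG : HasSign G C i 1) {X : Plane} (hX : G X = X)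
    {s : ℝ} (hs : s = 1 ∨ s = -1) {D A : Set Plane} (hD : Bornology.IsBounded D)
    (hXD : X ∈ interior D) (hA : ∀ Q, c * ‖Q - X‖ ≤ s * (Q i - X i) → Q ∈ A)
    (hDA : ∀ Q ∈ D, Q ∈ A → G Q ∈ D) : False := by
  obtain ⟨γ, v, m, hm, hγ, hγ0, hγU, hv⟩ := C.exists_isArc i hs
    (S.coord_ne_zero (C.axis_mem X) (C.axis_ne_zero X)) (isOpen_interior.mem_nhds hXD)
  have hγ' : IsArc C i s 0 1 γ v := hγ.mono (by norm_num) le_rfl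
  have hmaps := S.mapsArcs hG
  refine hmaps.not_bounded S.one_lt (by simp) S.pos S.le_coord (abs_eq_one_of_sign hs) zero_lt_one
    hm hγ' (fun t _ => hv t) hD fun n => ?_
  induction n with
  | zero => exact fun t ht => interior_subset (hγU t ⟨by linarith [ht.1], ht.2⟩)
  | succ n ih =>
    intro t ht
    rw [Function.iterate_succ_apply']
    -- Every iterate of the half arc still starts at the fixed point and runs in direction `s`, so
    -- its chords from `X` satisfy the condition in `hA`.
    refine hDA _ (ih t ht) (hA _ ?_)
    obtain ⟨w, hw, -⟩ := hmaps.iterate S.one_lt n s 0 1 γ v hγ'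
    rw [one_pow, one_mul] at hw
    have := hw.chord_le (abs_eq_one_of_sign hs) S.pos S.le_coord (left_mem_Icc.2 zero_le_one) ht ht.1
    have hfix : G^[n] X = X := Function.iterate_fixed hX n
    simpa only [Function.comp_apply, hγ0, hfix] using this

/-! ### Signs of the branches and position of the fixed points -/

namespace SynchronouslyHyperbolic

variable {F₁ F₂ : PlaneDiffeo} (H : SynchronouslyHyperbolic F₁ F₂)

/-- With equal signs the piecewise map would stretch unstable arcs without limit inside the bounded
set `D`. -/
theorem sign_ne {D : Set Plane} (hD : IsDiskTrappingRegion H.map D) {τ₁ τ₂ : ℝ}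
    (hτ : τ₁ = 1 ∨ τ₁ = -1) (h₁ : HasSign F₁ H.Cu 0 τ₁) (h₂ : HasSign F₂ H.Cu 0 τ₂) : τ₁ ≠ τ₂ := by
  rintro rfl
  exact (H.mapsArcs_map h₁ h₂).not_mapsTo H.one_lt_lam (abs_eq_one_of_sign hτ) H.K.coeffU_mem.1
    H.le_coord_unstable hD.isBounded hD.trapping.interior_nonempty fun P hP => hD.trapping.map_mem hP

/-- The signs of `F₁` and `F₂` on the unstable cones are different. -/
theorem sign_cases {D : Set Plane} (hD : IsDiskTrappingRegion H.map D) :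
    (HasSign F₁ H.Cu 0 1 ∧ HasSign F₂ H.Cu 0 (-1)) ∨
      (HasSign F₁ H.Cu 0 (-1) ∧ HasSign F₂ H.Cu 0 1) := by
  obtain ⟨τ₁, hτ₁, h₁⟩ := (H.expandsCones H.hyperbolic₁).exists_hasSign
  obtain ⟨τ₂, hτ₂, h₂⟩ := (H.expandsCones H.hyperbolic₂).exists_hasSign
  have hne := H.sign_ne hD hτ₁ h₁ h₂
  rcases hτ₁ with rfl | rfl <;> rcases hτ₂ with rfl | rfl
  · exact absurd rfl hne
  · exact Or.inl ⟨h₁, h₂⟩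
  · exact Or.inr ⟨h₁, h₂⟩
  · exact absurd rfl hne

/-- A connected region off the divider lies in one half-plane, where a single branch would map it
into itself while stretching its arcs. -/
theorem inter_divider_nonempty {D : Set Plane} (hD : IsDiskTrappingRegion H.map D) :
    (D ∩ H.divider).Nonempty := by
  by_contra hemp
  have hno : ∀ P ∈ D, P 0 ≠ H.g (P 1) := fun P hP h => hemp ⟨P, hP, h⟩
  have hcase : D ⊆ H.left ∨ D ⊆ H.right := by
    refine hD.isPreconnected.subset_or_subset H.isOpen_left H.isOpen_right
      H.disjoint_left_right fun P hP => (hno P hP).lt_or_gt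
  have key : ∀ G : PlaneDiffeo, HyperbolicFor G H.lam H.Cu H.Cs → ¬ MapsTo G D D := by
    intro G hG
    obtain ⟨τ, hτ, h⟩ := (H.expandsCones hG).exists_hasSign
    exact ((H.expandsCones hG).mapsArcs h).not_mapsTo H.one_lt_lam (abs_eq_one_of_sign hτ)
      H.K.coeffU_mem.1 H.le_coord_unstable hD.isBounded hD.trapping.interior_nonempty
  rcases hcase with h | h
  · refine key F₁ H.hyperbolic₁ fun P hP => ?_
    rw [← H.map_of_le (le_of_lt (h hP))]; exact hD.trapping.map_mem hP
  · refine key F₂ H.hyperbolic₂ fun P hP => ?_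
    rw [← H.map_of_ge (le_of_lt (h hP))]; exact hD.trapping.map_mem hP

/-- From a fixed point in the closed left half-plane, the half arc going left would remain there and
in `D` under all iterates of `F₁`, while growing. -/
theorem fixedPoint_mem_right {D : Set Plane} (hD : IsDiskTrappingRegion H.map D)
    (h₁ : HasSign F₁ H.Cu 0 1) {X : Plane} (hX : X ∈ D) (hfix : H.map X = X) : X ∈ H.right := by
  by_contra hcon
  have hle : X 0 ≤ H.g (X 1) := not_lt.1 hcon
  have hXi : X ∈ interior D := hfix ▸ hD.trapping.map_mem_interior hX
  refine (H.expandsCones H.hyperbolic₁).not_fixedPoint h₁ (by rw [← H.map_of_le hle, hfix])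
    (Or.inr rfl) hD.isBounded hXi (A := {Q | Q 0 ≤ H.g (Q 1)})
    (fun Q hQ => H.le_of_chord hQ hle) fun Q hQ hQA => by
      rw [← H.map_of_le hQA]; exact hD.trapping.map_mem hQ

theorem fixedPoint_mem_left {D : Set Plane} (hD : IsDiskTrappingRegion H.map D)
    (h₂ : HasSign F₂ H.Cu 0 1) {X : Plane} (hX : X ∈ D) (hfix : H.map X = X) : X ∈ H.left := by
  by_contra hcon
  have hle : H.g (X 1) ≤ X 0 := not_lt.1 hcon
  have hXi : X ∈ interior D := hfix ▸ hD.trapping.map_mem_interior hX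
  refine (H.expandsCones H.hyperbolic₂).not_fixedPoint h₂ (by rw [← H.map_of_ge hle, hfix])
    (Or.inl rfl) hD.isBounded hXi (A := {Q | H.g (Q 1) ≤ Q 0})
    (fun Q hQ => H.ge_of_chord hQ hle) fun Q hQ hQA => by
      rw [← H.map_of_ge hQA]; exact hD.trapping.map_mem hQ

theorem exists_fixedPoint {D : Set Plane} (hD : IsDiskTrappingRegion H.map D) :
    ∃ X ∈ D, H.map X = X := by
  obtain ⟨e⟩ := hD.closedDisk
  have hm : ∀ P ∈ closure D, H.map P ∈ interior D :=
    fun P hP => hD.trapping.2 (mem_image_of_mem _ hP)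
  obtain ⟨X, hX, hfix⟩ := exists_fixedPoint_of_homeomorph_closedBall e H.continuous_map.continuousOn
    fun P hP => subset_closure (interior_subset (hm P hP))
  exact ⟨X, interior_subset (hfix ▸ hm X hX), hfix⟩

end SynchronouslyHyperbolic

/-! ### Uniqueness of the fixed point of a hyperbolic diffeomorphism -/

/-- A point that lies in the horizontal cone of `P` and in the vertical cone of `Q` is at bounded
distance from both. -/
theorem bounds_of_mem_cones {α β : ℝ} (hα : 0 ≤ α) (hβ : 0 ≤ β) (hαβ : α * β < 1) {P Q R : Plane}
    (h₁ : |R 1 - P 1| ≤ α * |R 0 - P 0|) (h₂ : |R 0 - Q 0| ≤ β * |R 1 - Q 1|) :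
    |R 0 - P 0| ≤ (|P 0 - Q 0| + β * |P 1 - Q 1|) / (1 - α * β) ∧
      |R 1 - Q 1| ≤ α * ((|P 0 - Q 0| + β * |P 1 - Q 1|) / (1 - α * β)) + |P 1 - Q 1| := by
  have h3 : |R 1 - Q 1| ≤ |R 1 - P 1| + |P 1 - Q 1| := abs_sub_le _ _ _
  have h4 : |R 0 - P 0| ≤ |R 0 - Q 0| + |P 0 - Q 0| := by
    rw [abs_sub_comm (P 0)]; exact abs_sub_le _ _ _
  -- Inserting one cone bound into the other leaves the factor `1 - α * β` on the left.
  have h5 : |R 0 - P 0| ≤ (|P 0 - Q 0| + β * |P 1 - Q 1|) / (1 - α * β) := by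
    rw [le_div_iff₀ (by linarith)]
    have := mul_le_mul_of_nonneg_left (h3.trans (add_le_add_left h₁ _)) hβ
    nlinarith
  exact ⟨h5, by have := mul_le_mul_of_nonneg_left h5 hα; linarith⟩

/-- A long curve that is a Lipschitz graph over the horizontal axis meets a long curve that is a
Lipschitz graph over the vertical axis. -/
theorem exists_crossing {α β : ℝ} (hα : 0 ≤ α) (hβ : 0 ≤ β) (hαβ : α * β < 1) {P Q : Plane}
    {p q : ℝ → Plane} (hp : ContinuousOn p (Icc (-1) 1)) (hq : ContinuousOn q (Icc (-1) 1))
    (hq0 : q 0 = Q)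
    (hpα : ∀ t ∈ Icc (-1 : ℝ) 1, |p t 1 - P 1| ≤ α * |p t 0 - P 0|)
    (hpα' : ∀ t ∈ Icc (-1 : ℝ) 1, ∀ t' ∈ Icc (-1 : ℝ) 1, |q t 0 - q t' 0| ≤ β * |q t 1 - q t' 1|)
    {σ ρ : ℝ} (hσ : |σ| = 1) (hρ : |ρ| = 1)
    (h1 : (|P 0 - Q 0| + β * |P 1 - Q 1|) / (1 - α * β) ≤ σ * (p 1 0 - P 0))
    (h2 : (|P 0 - Q 0| + β * |P 1 - Q 1|) / (1 - α * β) ≤ σ * (P 0 - p (-1) 0))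
    (h3 : α * ((|P 0 - Q 0| + β * |P 1 - Q 1|) / (1 - α * β)) + |P 1 - Q 1| ≤ ρ * (q 1 1 - Q 1))
    (h4 : α * ((|P 0 - Q 0| + β * |P 1 - Q 1|) / (1 - α * β)) + |P 1 - Q 1| ≤
      ρ * (Q 1 - q (-1) 1)) :
    ∃ t ∈ Icc (-1 : ℝ) 1, ∃ r ∈ Icc (-1 : ℝ) 1, p t = q r := by
  set B := (|P 0 - Q 0| + β * |P 1 - Q 1|) / (1 - α * β) with hB
  set B' := α * B + |P 1 - Q 1| with hB'
  have hd : 0 < 1 - α * β := by linarith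
  have hB0 : 0 ≤ B := div_nonneg (by positivity) hd.le
  have hBeq : B * (1 - α * β) = |P 0 - Q 0| + β * |P 1 - Q 1| := div_mul_cancel₀ _ hd.ne'
  have hB'0 : 0 ≤ B' := by positivity
  have sgn : ∀ {x : ℝ}, |x| = 1 → x = 1 ∨ x = -1 := fun h => eq_or_eq_neg_of_abs_eq h
  have hm1 : (-1 : ℝ) ∈ Icc (-1 : ℝ) 1 := by norm_num
  have hp1 : (1 : ℝ) ∈ Icc (-1 : ℝ) 1 := by norm_num
  have hz : (0 : ℝ) ∈ Icc (-1 : ℝ) 1 := by norm_num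
  have hc0 : ContinuousOn (fun t => p t 0) (Icc (-1) 1) := (coord 0).continuous.comp_continuousOn hp
  have hc1 : ContinuousOn (fun t => p t 1) (Icc (-1) 1) := (coord 1).continuous.comp_continuousOn hp
  have hd1 : ContinuousOn (fun t => q t 1) (Icc (-1) 1) := (coord 1).continuous.comp_continuousOn hq
  have hsurj : ∀ y ∈ Icc (Q 1 - B') (Q 1 + B'), ∃ r ∈ Icc (-1 : ℝ) 1, q r 1 = y := by
    intro y hy
    rcases sgn hρ with rfl | rfl
    · exact isPreconnected_Icc.intermediate_value hm1 hp1 hd1 ⟨by linarith [hy.1], by linarith [hy.2]⟩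
    · exact isPreconnected_Icc.intermediate_value hp1 hm1 hd1 ⟨by linarith [hy.1], by linarith [hy.2]⟩
  choose! ρ' hρ'mem hρ' using hsurj
  have hle : Q 1 - B' ≤ Q 1 + B' := by linarith
  -- Clamping to heights that `q` is known to reach makes `ψ`, which describes `q` as a graph over
  -- the vertical axis, a `β`-Lipschitz function on all of `ℝ`.
  set k : ℝ → ℝ := fun y => projIcc _ _ hle y with hk
  have hkmem : ∀ y, k y ∈ Icc (Q 1 - B') (Q 1 + B') := fun y => (projIcc _ _ hle y).2
  have hklip : ∀ y y', |k y - k y'| ≤ |y - y'| := fun y y' => abs_projIcc_sub_projIcc hle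
  have hkid : ∀ y ∈ Icc (Q 1 - B') (Q 1 + B'), k y = y := fun y hy => by
    simp only [hk, projIcc_of_mem hle hy]
  set ψ : ℝ → ℝ := fun y => q (ρ' (k y)) 0 with hψ
  have hψlip : ∀ y y', |ψ y - ψ y'| ≤ β * |y - y'| := by
    intro y y'
    refine (hpα' _ (hρ'mem _ (hkmem y)) _ (hρ'mem _ (hkmem y'))).trans ?_
    rw [hρ' _ (hkmem y), hρ' _ (hkmem y')]
    exact mul_le_mul_of_nonneg_left (hklip y y') hβ
  have hψQ : ∀ y, |ψ y - Q 0| ≤ β * |y - Q 1| := by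
    intro y
    have := hpα' _ (hρ'mem _ (hkmem y)) 0 hz
    rw [hρ' _ (hkmem y), hq0] at this
    refine this.trans (mul_le_mul_of_nonneg_left ?_ hβ)
    have h5 := hklip y (Q 1)
    rwa [hkid (Q 1) ⟨by linarith, by linarith⟩] at h5
  have hψc : Continuous ψ := by
    have : LipschitzWith ⟨β, hβ⟩ ψ := LipschitzWith.of_dist_le_mul fun y y' => hψlip y y'
    exact this.continuous
  have hhc : ContinuousOn (fun t => ψ (p t 1) - p t 0) (Icc (-1) 1) :=
    (hψc.comp_continuousOn hc1).sub hc0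
  -- The two slopes compose to the contraction factor `α * β`, so at horizontal distance `B` or more
  -- from `P` the sign of `ψ (p t 1) - p t 0` is determined.
  have hbd : ∀ t ∈ Icc (-1 : ℝ) 1, |ψ (p t 1) - P 0| ≤ (1 - α * β) * B + α * β * |p t 0 - P 0| := by
    intro t ht
    have e1 := hψQ (p t 1)
    have e2 : |p t 1 - Q 1| ≤ |p t 1 - P 1| + |P 1 - Q 1| := abs_sub_le _ _ _
    have e3 := mul_le_mul_of_nonneg_left (e2.trans (add_le_add_left (hpα t ht) _)) hβ
    have e4 : |ψ (p t 1) - P 0| ≤ |ψ (p t 1) - Q 0| + |P 0 - Q 0| := by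
      rw [abs_sub_comm (P 0)]; exact abs_sub_le _ _ _
    linarith
  have hpos : ∀ t ∈ Icc (-1 : ℝ) 1, B ≤ p t 0 - P 0 → ψ (p t 1) - p t 0 ≤ 0 := by
    intro t ht hBt
    have e1 := (abs_le.1 (hbd t ht)).2
    rw [abs_of_nonneg (hB0.trans hBt)] at e1
    have := mul_le_mul_of_nonneg_left hBt hd.le
    linarith
  have hneg : ∀ t ∈ Icc (-1 : ℝ) 1, B ≤ P 0 - p t 0 → 0 ≤ ψ (p t 1) - p t 0 := by
    intro t ht hBt
    have e1 := (abs_le.1 (hbd t ht)).1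
    rw [abs_sub_comm, abs_of_nonneg (hB0.trans hBt)] at e1
    have := mul_le_mul_of_nonneg_left hBt hd.le
    linarith
  obtain ⟨t, ht, hzero⟩ : (0 : ℝ) ∈ (fun t => ψ (p t 1) - p t 0) '' Icc (-1 : ℝ) 1 := by
    rcases sgn hσ with rfl | rfl
    · exact isPreconnected_Icc.intermediate_value hp1 hm1 hhc
        ⟨hpos _ hp1 (by linarith), hneg _ hm1 (by linarith)⟩
    · exact isPreconnected_Icc.intermediate_value hm1 hp1 hhc
        ⟨hpos _ hm1 (by linarith), hneg _ hp1 (by linarith)⟩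
  have hx : ψ (p t 1) = p t 0 := sub_eq_zero.1 hzero
  -- The crossing was found for the clamped function; this bound shows that no clamping took place
  -- there.
  have hb := (bounds_of_mem_cones hα hβ hαβ (hpα t ht) (hx ▸ hψQ (p t 1))).2
  have hy : p t 1 ∈ Icc (Q 1 - B') (Q 1 + B') := by
    have := abs_le.1 hb
    exact ⟨by linarith [this.1], by linarith [this.2]⟩
  refine ⟨t, ht, ρ' (p t 1), hρ'mem _ hy, ?_⟩
  have hx' : q (ρ' (p t 1)) 0 = p t 0 := by
    rw [← hx, hψ]; simp only [hkid _ hy]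
  rw [← plane_eta (q (ρ' (p t 1))), hx', hρ' _ hy, plane_eta]

/-- The iterates of a short arc through a fixed point. -/
theorem ExpandsCones.exists_arcs {G : PlaneDiffeo} {lam : ℝ} {C : ConeField} {i : Fin 2} {c : ℝ}
    (S : ExpandsCones G lam C i c) {P : Plane} (hP : G P = P) :
    ∃ (γ : ℝ → Plane) (σ : ℕ → ℝ), ∃ m > 0, γ 0 = P ∧ (∀ n, |σ n| = 1) ∧
      (∀ n, ContinuousOn (G^[n] ∘ γ) (Icc (-1) 1)) ∧
      (∀ n, ∀ t ∈ Icc (-1 : ℝ) 1, ∀ t' ∈ Icc (-1 : ℝ) 1,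
        c * ‖G^[n] (γ t) - G^[n] (γ t')‖ ≤ |G^[n] (γ t) i - G^[n] (γ t') i|) ∧
      (∀ n, m * lam ^ n ≤ σ n * (G^[n] (γ 1) i - P i)) ∧
      (∀ n, m * lam ^ n ≤ σ n * (P i - G^[n] (γ (-1)) i)) ∧
      ∀ k n, ∀ t ∈ Icc (-1 : ℝ) 1,
        c * lam ^ k * ‖G^[n] (γ t) - P‖ ≤ |G^[k + n] (γ t) i - P i| := by
  obtain ⟨τ, hτ, hsign⟩ := S.exists_hasSign
  have hτ1 := abs_eq_one_of_sign hτ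
  obtain ⟨γ, v, m, hm, hγ, hγ0, -, hv⟩ := C.exists_isArc i (Or.inl rfl)
    (S.coord_ne_zero (C.axis_mem P) (C.axis_ne_zero P)) Filter.univ_mem
  have hl : 0 < lam := zero_lt_one.trans S.one_lt
  have hmaps := fun n => (S.mapsArcs hsign).iterate S.one_lt n
  have hσ : ∀ n, |τ ^ n * 1| = 1 := abs_pow_mul_eq_one hτ1 (by simp)
  have hfix : ∀ n, G^[n] (γ 0) = P := fun n => by rw [hγ0]; exact Function.iterate_fixed hP n
  have hm1 : (-1 : ℝ) ∈ Icc (-1 : ℝ) 1 := by norm_num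
  have hp1 : (1 : ℝ) ∈ Icc (-1 : ℝ) 1 := by norm_num
  have hz : (0 : ℝ) ∈ Icc (-1 : ℝ) 1 := by norm_num
  have habs : ∀ {x y : ℝ}, |x| = 1 → x * y ≤ |y| := fun {x y} hx => by
    refine (le_abs_self _).trans ?_
    rw [abs_mul, hx, one_mul]
  have hgrow : ∀ n, ∃ w, IsArc C i (τ ^ n * 1) (-1) 1 (G^[n] ∘ γ) w ∧
      ∀ t ∈ Ico (-1 : ℝ) 1, lam ^ n * m ≤ ‖w t‖ := by
    intro n
    obtain ⟨w, hw, hwn⟩ := hmaps n _ _ _ _ _ hγ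
    exact ⟨w, hw, fun t ht => (mul_le_mul_of_nonneg_left (hv t) (by positivity)).trans (hwn t ht)⟩
  refine ⟨γ, fun n => τ ^ n * 1, c * m, mul_pos S.pos hm, hγ0, hσ, fun n => ?_, fun n => ?_,
    fun n => ?_, fun n => ?_, fun k n => ?_⟩
  · obtain ⟨w, hw, -⟩ := hmaps n _ _ _ _ _ hγ
    exact hw.cont
  · obtain ⟨w, hw, -⟩ := hmaps n _ _ _ _ _ hγ
    intro t ht t' ht'
    rcases le_total t' t with h | h
    · exact (hw.chord_le (hσ n) S.pos S.le_coord ht' ht h).trans (habs (hσ n))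
    · rw [norm_sub_rev, abs_sub_comm]
      exact (hw.chord_le (hσ n) S.pos S.le_coord ht ht' h).trans (habs (hσ n))
  · obtain ⟨w, hw, hwn⟩ := hgrow n
    have := hw.growth (hσ n) S.pos S.le_coord (by positivity) hwn hz hp1 zero_le_one
    simp only [Function.comp_apply, hfix] at this
    linarith
  · obtain ⟨w, hw, hwn⟩ := hgrow n
    have := hw.growth (hσ n) S.pos S.le_coord (by positivity) hwn hm1 hz (by norm_num)
    simp only [Function.comp_apply, hfix] at this
    linarith
  · obtain ⟨w, hw, -⟩ := hmaps n _ _ _ _ _ hγ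
    -- Treating the `n`-th image as an arc in its own right gives the factor `lam ^ k` between
    -- displacements from `P`.
    obtain ⟨z, hz', hzn⟩ := hmaps k _ _ _ _ _ hw
    intro t ht
    have hs1 := abs_pow_mul_eq_one hτ1 (hσ n) k
    have e : ∀ x, (G^[k] ∘ G^[n] ∘ γ) x = G^[k + n] (γ x) := fun x => by
      rw [Function.iterate_add]; rfl
    rcases le_total t 0 with h | h
    · have := hz'.norm_sub_le hs1 S.pos S.le_coord (by positivity) hw.cont hw.deriv hzn ht hz h
      rw [e, e, Function.comp_apply, Function.comp_apply, hfix, hfix] at this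
      rw [norm_sub_rev, abs_sub_comm]
      exact this.trans (habs hs1)
    · have := hz'.norm_sub_le hs1 S.pos S.le_coord (by positivity) hw.cont hw.deriv hzn hz ht h
      rw [e, e, Function.comp_apply, Function.comp_apply, hfix, hfix] at this
      exact this.trans (habs hs1)

/-- A hyperbolic diffeomorphism has at most one fixed point. -/
theorem SynchronouslyHyperbolic.fixedPoint_unique {F₁ F₂ : PlaneDiffeo}
    (H : SynchronouslyHyperbolic F₁ F₂) {G : PlaneDiffeo} (hG : HyperbolicFor G H.lam H.Cu H.Cs)
    {P Q : Plane} (hP : G P = P) (hQ : G Q = Q) : P = Q := by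
  obtain ⟨α, β, hα, hβ, hαβ, hu, hs⟩ := H.K.exists_slopes
  have hQ' : G.symm Q = Q := by
    nth_rewrite 1 [← hQ]; exact G.symm_apply_apply Q
  obtain ⟨γ, σ, m, hm, hγ0, hσ, hγc, hγK, hγ1, hγ2, hγ3⟩ := (H.expandsCones hG).exists_arcs hP
  obtain ⟨δ, ρ, m', hm', hδ0, hρ, hδc, hδK, hδ1, hδ2, hδ3⟩ :=
    (H.expandsCones_symm hG).exists_arcs hQ'
  have hz : (0 : ℝ) ∈ Icc (-1 : ℝ) 1 := by norm_num
  have hγα : ∀ n, ∀ t ∈ Icc (-1 : ℝ) 1, |G^[n] (γ t) 1 - P 1| ≤ α * |G^[n] (γ t) 0 - P 0| := by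
    intro n t ht
    have h := hu _ (mem_cone_fst.2 (hγK n t ht 0 hz))
    rwa [hγ0, Function.iterate_fixed hP n] at h
  have hδβ : ∀ n, ∀ t ∈ Icc (-1 : ℝ) 1, ∀ t' ∈ Icc (-1 : ℝ) 1,
      |G.symm^[n] (δ t) 0 - G.symm^[n] (δ t') 0| ≤ β * |G.symm^[n] (δ t) 1 - G.symm^[n] (δ t') 1| :=
    fun n t ht t' ht' => hs _ (mem_cone_snd.2 (hδK n t ht t' ht'))
  have hδβ' : ∀ n, ∀ t ∈ Icc (-1 : ℝ) 1,
      |G.symm^[n] (δ t) 0 - Q 0| ≤ β * |G.symm^[n] (δ t) 1 - Q 1| := by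
    intro n t ht
    have h := hδβ n t ht 0 hz
    rwa [hδ0, Function.iterate_fixed hQ' n] at h
  set B := (|P 0 - Q 0| + β * |P 1 - Q 1|) / (1 - α * β) with hB
  set B' := α * B + |P 1 - Q 1| with hB'
  have hcu := H.K.coeffU_mem.1
  have hcs := H.K.coeffS_mem.1
  have hleft : ∀ n, Function.LeftInverse (G^[n]) (G.symm^[n]) := fun n =>
    Function.LeftInverse.iterate G.apply_symm_apply n
  have hright : ∀ n, Function.LeftInverse (G.symm^[n]) (G^[n]) := fun n =>
    Function.LeftInverse.iterate G.symm_apply_apply n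
  -- Long arcs cross. Applying `G` another `n` times brings the crossing point onto the initial arc
  -- `δ` and keeps it on an image of `γ`, so it is boundedly far from `P`; hence before that it was
  -- within order `lam ^ (-n)` of `P`. The inverse gives the same for `Q`.
  have hev : ∀ n, B ≤ m * H.lam ^ n → B' ≤ m' * H.lam ^ n →
      ‖P - Q‖ * H.lam ^ n ≤ B / H.K.coeffU + B' / H.K.coeffS := by
    intro n hn hn'
    obtain ⟨t, ht, r, hr, htr⟩ := exists_crossing hα hβ hαβ (P := P) (Q := Q) (hγc n) (hδc n)
      (by simp only [Function.comp_apply, hδ0, Function.iterate_fixed hQ' n])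
      (hγα n) (hδβ n) (hσ n) (hρ n) (hn.trans (hγ1 n)) (hn.trans (hγ2 n))
      (hn'.trans (hδ1 n)) (hn'.trans (hδ2 n))
    simp only [Function.comp_apply] at htr
    have e1 : G^[n + n] (γ t) = δ r := by
      rw [Function.iterate_add_apply, htr, hleft]
    have e2 : G.symm^[n + n] (δ r) = γ t := by
      rw [Function.iterate_add_apply, ← htr, hright]
    have b1 := (bounds_of_mem_cones hα hβ hαβ (hγα (n + n) t ht) (e1 ▸ hδβ' 0 r hr)).1
    have b2 := (bounds_of_mem_cones hα hβ hαβ (e2 ▸ hγα 0 t ht) (hδβ' (n + n) r hr)).2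
    have c1 := (hγ3 n n t ht).trans b1
    have c2 := (hδ3 n n r hr).trans b2
    rw [← htr] at c2
    have d1 : H.lam ^ n * ‖G^[n] (γ t) - P‖ ≤ B / H.K.coeffU := by
      rw [le_div_iff₀ hcu]; linarith
    have d2 : H.lam ^ n * ‖G^[n] (γ t) - Q‖ ≤ B' / H.K.coeffS := by
      rw [le_div_iff₀ hcs]; linarith
    have tri : ‖P - Q‖ ≤ ‖G^[n] (γ t) - P‖ + ‖G^[n] (γ t) - Q‖ := by
      rw [norm_sub_rev (G^[n] (γ t)) P]; exact norm_sub_le_norm_sub_add_norm_sub _ _ _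
    have hl : 0 ≤ H.lam ^ n := pow_nonneg (zero_le_one.trans H.one_lt_lam.le) n
    have := mul_le_mul_of_nonneg_left tri hl
    linarith
  by_contra hne
  have hpos : 0 < ‖P - Q‖ := norm_pos_iff.2 (sub_ne_zero.2 hne)
  have htend := tendsto_pow_atTop_atTop_of_one_lt H.one_lt_lam
  obtain ⟨n, h1, h2, h3⟩ := ((htend.eventually_ge_atTop (B / m)).and
    ((htend.eventually_ge_atTop (B' / m')).and
      (htend.eventually_gt_atTop ((B / H.K.coeffU + B' / H.K.coeffS) / ‖P - Q‖)))).exists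
  rw [div_le_iff₀' hm] at h1
  rw [div_le_iff₀' hm'] at h2
  rw [div_lt_iff₀' hpos] at h3
  exact absurd (hev n h1 h2) (not_le.2 h3)

/-! ### Determinants and eigenvalues in the plane -/

/-- The determinant of two vectors of the plane. -/
def cross (u w : Plane) : ℝ := u 0 * w 1 - u 1 * w 0

theorem cross_map (A : Plane →L[ℝ] Plane) (u w : Plane) :
    cross (A u) (A w) = A.det * cross u w := by
  set b := (EuclideanSpace.basisFun (Fin 2) ℝ).toBasis with hb
  have hexp : ∀ u : Plane, u = u 0 • b 0 + u 1 • b 1 := by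
    intro u; ext i; fin_cases i <;> simp [hb]
  have hA : ∀ u : Plane, ∀ i, A u i = u 0 * A (b 0) i + u 1 * A (b 1) i := by
    intro u i
    conv_lhs => rw [hexp u]
    simp
  have hdet : A.det = A (b 0) 0 * A (b 1) 1 - A (b 1) 0 * A (b 0) 1 := by
    rw [ContinuousLinearMap.det, ← LinearMap.det_toMatrix b, Matrix.det_fin_two]
    simp [LinearMap.toMatrix_apply, hb]
  simp only [cross, hA u, hA w, hdet]
  ring

/-- The product of the eigenvalues is the determinant. -/
theorem hasEigenvalue_det_div {A : Plane →L[ℝ] Plane} {μ : ℝ} (hμ : μ ≠ 0)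
    (h : Module.End.HasEigenvalue (A : Plane →ₗ[ℝ] Plane) μ) :
    Module.End.HasEigenvalue (A : Plane →ₗ[ℝ] Plane) (A.det / μ) := by
  set b := (EuclideanSpace.basisFun (Fin 2) ℝ).toBasis with hb
  rw [Module.End.hasEigenvalue_iff_isRoot_charpoly, ← LinearMap.charpoly_toMatrix _ b,
    Matrix.charpoly_fin_two, LinearMap.det_toMatrix, Polynomial.IsRoot.def] at h ⊢
  simp only [Polynomial.eval_add, Polynomial.eval_sub, Polynomial.eval_pow, Polynomial.eval_X,
    Polynomial.eval_mul, Polynomial.eval_C] at h ⊢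
  rw [ContinuousLinearMap.det]
  set D := LinearMap.det (A : Plane →ₗ[ℝ] Plane)
  set T := (LinearMap.toMatrix b b (A : Plane →ₗ[ℝ] Plane)).trace
  -- Up to a factor, the characteristic polynomial takes the same value at `μ` and at `D / μ`.
  have : (D / μ) ^ 2 - T * (D / μ) + D = D / μ ^ 2 * (μ ^ 2 - T * μ + D) := by
    field_simp; ring
  rw [this, h, mul_zero]

theorem hasEigenvalue_of_apply_eq {A : Plane →L[ℝ] Plane} {μ : ℝ} {v : Plane} (hv : v ≠ 0)
    (h : A v = μ • v) : Module.End.HasEigenvalue (A : Plane →ₗ[ℝ] Plane) μ :=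
  Module.End.hasEigenvalue_of_hasEigenvector (x := v)
    (Module.End.hasEigenvector_iff.2 ⟨Module.End.mem_eigenspace_iff.2 h, hv⟩)

/-- Eigenvectors for different eigenvalues are linearly independent. -/
theorem cross_ne_zero_of_hasEigenvector {A : Plane →ₗ[ℝ] Plane} {μ ν : ℝ} {v w : Plane}
    (hv : Module.End.HasEigenvector A μ v) (hw : Module.End.HasEigenvector A ν w) (hne : μ ≠ ν) :
    cross v w ≠ 0 := by
  intro h0
  -- Used with `r` a coordinate: a vanishing cross product supplies the linear relation, and
  -- applying `A` to it separates the two eigenvalues.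
  have hdep : ∀ r : Plane → ℝ, (∀ x, ∀ c : ℝ, r (c • x) = c * r x) → r v • w = r w • v →
      r v = 0 := by
    intro r hr h
    have h1 : A (r v • w) = A (r w • v) := by rw [h]
    rw [map_smul, map_smul, hv.apply_eq_smul, hw.apply_eq_smul, smul_comm, smul_comm (r w), h,
      ← sub_eq_zero, ← sub_smul, smul_smul] at h1
    rcases smul_eq_zero.1 h1 with h2 | h2
    · have h3 : r w = 0 := (mul_eq_zero.1 h2).resolve_left (sub_ne_zero.2 hne.symm)
      rw [h3, zero_smul] at h
      exact (smul_eq_zero.1 h).resolve_right hw.2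
    · exact absurd h2 hv.2
  simp only [cross] at h0
  have a0 : v 0 = 0 := hdep (fun x => x 0) (fun _ _ => rfl) (by
    ext i; fin_cases i
    · simp [mul_comm]
    · simp only [Fin.mk_one, PiLp.smul_apply, smul_eq_mul]; linarith)
  have a1 : v 1 = 0 := hdep (fun x => x 1) (fun _ _ => rfl) (by
    ext i; fin_cases i
    · simp only [Fin.zero_eta, PiLp.smul_apply, smul_eq_mul]; linarith
    · simp [mul_comm])
  apply hv.2
  rw [← plane_eta v, a0, a1]
  ext i; fin_cases i <;> simp

/-- A linear map that maps a cone into itself and does not vanish on it has an eigenvector in the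
cone. -/
theorem exists_eigenvector_mem_cone {A : Plane →L[ℝ] Plane} {a : Plane} {l : ℝ} (ha : ‖a‖ = 1)
    (hl : l ∈ Ioo (0 : ℝ) 1) (hA : ∀ u ∈ cone a l, A u ∈ cone a l)
    (hA0 : ∀ u ∈ cone a l, u ≠ 0 → A u ≠ 0) :
    ∃ v ∈ cone a l, v ≠ 0 ∧ ∃ μ : ℝ, A v = μ • v := by
  have ha2 : a 0 ^ 2 + a 1 ^ 2 = 1 := by rw [← norm_sq_plane, ha, one_pow]
  have hin : ∀ u : Plane, inner ℝ u a = u 0 * a 0 + u 1 * a 1 := by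
    intro u; simp [PiLp.inner_apply, Fin.sum_univ_two, mul_comm]
  set k := √(1 - l ^ 2) / l with hk
  have hk0 : 0 ≤ k := div_nonneg (Real.sqrt_nonneg _) hl.1.le
  have hkl : l ^ 2 * (1 + k ^ 2) = 1 := by
    rw [hk, div_pow, Real.sq_sqrt (by nlinarith [hl.1, hl.2])]
    have := hl.1.ne'
    field_simp; ring
  set b : Plane := !₂[-a 1, a 0] with hb
  -- Parametrizes the cone's directions by a line orthogonal to the axis; `k` is the tangent of the
  -- half-opening angle.
  set u : ℝ → Plane := fun t => a + t • b with hu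
  have hu0 : ∀ t, u t 0 = a 0 - t * a 1 := fun t => by simp [hu, hb]; ring
  have hu1 : ∀ t, u t 1 = a 1 + t * a 0 := fun t => by simp [hu, hb]
  have huin : ∀ t, inner ℝ (u t) a = 1 := fun t => by rw [hin, hu0, hu1]; linear_combination ha2
  have hune : ∀ t, u t ≠ 0 := fun t h => by
    have := huin t; rw [h, inner_zero_left] at this; exact zero_ne_one this
  have humem : ∀ t ∈ Icc (-k) k, u t ∈ cone a l := by
    intro t ht
    simp only [cone, mem_ofPred_eq, huin, abs_one]
    have h1 : ‖u t‖ ^ 2 = 1 + t ^ 2 := by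
      rw [norm_sq_plane, hu0, hu1]; linear_combination (1 + t ^ 2) * ha2
    have h2 : t ^ 2 ≤ k ^ 2 := sq_le_sq' ht.1 ht.2
    have h3 : (l * ‖u t‖) ^ 2 ≤ 1 ^ 2 := by
      rw [mul_pow, h1, one_pow, ← hkl]
      exact mul_le_mul_of_nonneg_left (by linarith) (sq_nonneg l)
    exact le_of_sq_le_sq h3 zero_le_one
  -- Coordinates along `a` and `b`: the vector `A (u t)` is a multiple of `u t` exactly when `q = t
  -- * p` there.
  set p : Plane → ℝ := fun y => y 0 * a 0 + y 1 * a 1 with hp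
  set q : Plane → ℝ := fun y => y 1 * a 0 - y 0 * a 1 with hq
  have hpcone : ∀ y ∈ cone a l, l * ‖y‖ ≤ |p y| := by
    intro y hy
    simpa only [cone, mem_ofPred_eq, hin] using hy
  have hpq : ∀ y ∈ cone a l, |q y| ≤ k * |p y| := by
    intro y hy
    refine abs_le_of_mul_norm_le hl (norm_nonneg y) ?_ (hpcone y hy)
    rw [norm_sq_plane]; simp only [hp, hq]; linear_combination (-(y 0 ^ 2 + y 1 ^ 2)) * ha2
  set φ : Plane →L[ℝ] ℝ := (innerSL ℝ a).comp A with hφ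
  have hφp : ∀ x, φ x = p (A x) := fun x => by
    simp only [hφ, ContinuousLinearMap.comp_apply, innerSL_apply_apply, hp]
    rw [real_inner_comm, hin]
  have hφ0 : ∀ x ∈ cone a l, x ≠ 0 → φ x ≠ 0 := by
    intro x hx hx0 h0
    have h1 : l * ‖A x‖ ≤ |p (A x)| := hpcone _ (hA x hx)
    rw [← hφp, h0, abs_zero] at h1
    linarith [mul_pos hl.1 (norm_pos_iff.2 (hA0 x hx hx0))]
  have hsign : ∀ t ∈ Icc (-k) k, 0 < p (A (u t)) * φ a := by
    intro t ht
    have := inner_mul_pos_of_ne_zero_on_cone ha hl φ hφ0 (humem t ht) (hune t)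
    rwa [huin, one_mul, hφp] at this
  have hbound : ∀ t ∈ Icc (-k) k, |q (A (u t)) * φ a| ≤ k * (p (A (u t)) * φ a) := by
    intro t ht
    have h1 := mul_le_mul_of_nonneg_right (hpq _ (hA _ (humem t ht))) (abs_nonneg (φ a))
    rwa [mul_assoc, ← abs_mul, ← abs_mul, abs_of_pos (hsign t ht)] at h1
  have hkk : k ∈ Icc (-k) k := ⟨by linarith, le_rfl⟩
  have hkk' : -k ∈ Icc (-k) k := ⟨le_rfl, by linarith⟩
  have hcont : ContinuousOn (fun t => (q (A (u t)) - t * p (A (u t))) * φ a) (Icc (-k) k) := by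
    have h1 : Continuous fun t => A (u t) := A.continuous.comp (by fun_prop)
    have h2 : Continuous fun t => A (u t) 0 := (coord 0).continuous.comp h1
    have h3 : Continuous fun t => A (u t) 1 := (coord 1).continuous.comp h1
    simp only [hp, hq]
    fun_prop
  -- Invariance of the cone bounds `|q|` by `k * |p|`, so `q - t * p`, normalized by the sign of `φ
  -- a`, has opposite weak signs at `t = k` and `t = -k`.
  obtain ⟨t, ht, hzero⟩ := isPreconnected_Icc.intermediate_value hkk hkk' hcont
    (show (0 : ℝ) ∈ Icc _ _ from ⟨by
      have := (abs_le.1 (hbound k hkk)).2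
      simp only [sub_mul]; linarith, by
      have := (abs_le.1 (hbound (-k) hkk')).1
      simp only [sub_mul]; linarith⟩)
  refine ⟨u t, humem t ht, hune t, p (A (u t)), ?_⟩
  have hφa : φ a ≠ 0 := fun h => by have := hsign t ht; rw [h, mul_zero] at this; exact lt_irrefl _ this
  have hqt : q (A (u t)) - t * p (A (u t)) = 0 := (mul_eq_zero.1 hzero).resolve_right hφa
  simp only [hp, hq] at hqt ⊢
  ext i; fin_cases i
  · simp only [Fin.zero_eta, PiLp.smul_apply, smul_eq_mul, hu0]
    linear_combination (-(A (u t) 0)) * ha2 - a 1 * hqt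
  · simp only [Fin.mk_one, PiLp.smul_apply, smul_eq_mul, hu1]
    linear_combination (-(A (u t) 1)) * ha2 + a 0 * hqt

/-- Since the slopes have product below one, `u 0 * w 1` dominates `u 1 * w 0`; the orientation of a
transversal pair is read off from these two coordinates. -/
theorem UniversalPair.cross_mul_pos (K : UniversalPair) {u w : Plane} (hu : u ∈ K.Ku)
    (hw : w ∈ K.Ks) (hu0 : u ≠ 0) (hw0 : w ≠ 0) : 0 < cross u w * (u 0 * w 1) := by
  obtain ⟨α, β, hα, hβ, hαβ, hKu, hKs⟩ := K.exists_slopes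
  have h1 : u 0 ≠ 0 := by
    intro h
    have := mem_cone_fst.1 hu
    rw [h, abs_zero] at this
    linarith [mul_pos K.coeffU_mem.1 (norm_pos_iff.2 hu0)]
  have h2 : w 1 ≠ 0 := by
    intro h
    have := mem_cone_snd.1 hw
    rw [h, abs_zero] at this
    linarith [mul_pos K.coeffS_mem.1 (norm_pos_iff.2 hw0)]
  have h3 : |u 1 * w 0| ≤ α * β * |u 0 * w 1| := by
    rw [abs_mul, abs_mul]
    have := mul_le_mul (hKu u hu) (hKs w hw) (abs_nonneg _) (by positivity)
    linarith
  have h4 : 0 < |u 0 * w 1| := abs_pos.2 (mul_ne_zero h1 h2)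
  have h5 : |u 1 * w 0| < |u 0 * w 1| := by nlinarith
  have h6 : (u 1 * w 0) * (u 0 * w 1) ≤ |u 1 * w 0| * |u 0 * w 1| := by
    rw [← abs_mul]; exact le_abs_self _
  have h7 : (u 0 * w 1) * (u 0 * w 1) = |u 0 * w 1| * |u 0 * w 1| := (abs_mul_abs_self _).symm
  simp only [cross]
  nlinarith

/-! ### Eigenvalues and multipliers of a single branch -/

namespace SynchronouslyHyperbolic

variable {F₁ F₂ : PlaneDiffeo} (H : SynchronouslyHyperbolic F₁ F₂) {G : PlaneDiffeo}

theorem fderiv_symm_mem (hG : HyperbolicFor G H.lam H.Cu H.Cs) {P w : Plane}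
    (hw : w ∈ H.Cs.at (G P)) : fderiv ℝ G.symm (G P) w ∈ H.Cs.at P := by
  have := hG.map_stable (G P) w hw
  rwa [G.symm_apply_apply] at this

/-- For an orientation reversing diffeomorphism, the action on the orientation of the stable cones
is opposite to the one on the orientation of the unstable cones. -/
theorem stable_sign (hG : HyperbolicFor G H.lam H.Cu H.Cs) {τ : ℝ} (hτ : HasSign G H.Cu 0 τ)
    {P : Plane} (hdet : (fderiv ℝ G P).det < 0) {w : Plane} (hw : w ∈ H.Cs.at (G P)) (hw0 : w ≠ 0) :
    τ * (w 1 * fderiv ℝ G.symm (G P) w 1) < 0 := by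
  set z := fderiv ℝ G.symm (G P) w with hz
  have hAz : fderiv ℝ G P z = w := G.apply_fderiv_symm P w
  have hz0 : z ≠ 0 := by intro h; rw [h, map_zero] at hAz; exact hw0 hAz.symm
  have hzm : z ∈ H.Cs.at P := H.fderiv_symm_mem hG hw
  set u := H.Cu.axis P with hu
  have hum : u ∈ H.Cu.at P := H.Cu.axis_mem P
  have hu0 : u ≠ 0 := H.Cu.axis_ne_zero P
  have h1 := H.K.cross_mul_pos (H.unstable_subset _ hum) (H.stable_subset _ hzm) hu0 hz0
  have h2 := H.K.cross_mul_pos (H.unstable_subset _ (hG.map_unstable P u hum))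
    (H.stable_subset _ hw) ((H.expandsCones hG).fderiv_ne_zero hum hu0) hw0
  have h3 := cross_map (fderiv ℝ G P) u z
  rw [hAz] at h3
  have h4 := hτ P u hum hu0
  set y := fderiv ℝ G P u
  set D := (fderiv ℝ G P).det
  rw [h3] at h2
  -- The cross products before and after `DG` differ by the negative determinant, so exactly one of
  -- the two coordinate signs is reversed.
  have h5 := mul_pos (mul_pos h1 h2) h4
  have h6 : 0 < ((cross u z) ^ 2 * (u 0 * y 0) ^ 2) * (D * (τ * (w 1 * z 1))) := by linarith
  have h7 := pos_of_mul_pos_right h6 (by positivity)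
  nlinarith

/-- The cone at the fixed point is invariant and contains an eigenvector, whose eigenvalue inherits
the expansion and the sign `τ`. -/
theorem exists_eigenvalue_of_fixedPoint (hG : HyperbolicFor G H.lam H.Cu H.Cs) {τ : ℝ}
    (hτ : HasSign G H.Cu 0 τ) {P : Plane} (hP : G P = P) :
    ∃ μ : ℝ, Module.End.HasEigenvalue (fderiv ℝ G P : Plane →ₗ[ℝ] Plane) μ ∧ 1 < |μ| ∧
      0 < τ * μ := by
  obtain ⟨v, hv, hv0, μ, hμ⟩ := exists_eigenvector_mem_cone (A := fderiv ℝ G P)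
    (H.Cu.norm_axis P) (H.Cu.coeff_mem P) (fun u hu => by
      have := hG.map_unstable P u hu; rwa [hP] at this)
    (fun u hu hu0 => (H.expandsCones hG).fderiv_ne_zero hu hu0)
  refine ⟨μ, hasEigenvalue_of_apply_eq hv0 hμ, ?_, ?_⟩
  · have := hG.expand_unstable P v hv
    rw [hμ, norm_smul, Real.norm_eq_abs] at this
    exact H.one_lt_lam.trans_le (le_of_mul_le_mul_right this (norm_pos_iff.2 hv0))
  · have := hτ P v hv hv0
    rw [hμ, PiLp.smul_apply, smul_eq_mul] at this
    have h2 : 0 < (v 0) ^ 2 * (τ * μ) := by linarith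
    exact pos_of_mul_pos_right h2 (sq_nonneg _)

theorem hasFlippingEigenvalues (hG : HyperbolicFor G H.lam H.Cu H.Cs)
    (hτ : HasSign G H.Cu 0 (-1)) {P : Plane} (hP : G P = P)
    (hdet : (fderiv ℝ G P).det ∈ Ioo (-1 : ℝ) 0) : HasFlippingEigenvalues (fderiv ℝ G P) := by
  obtain ⟨μ, hμ, h1, h2⟩ := H.exists_eigenvalue_of_fixedPoint hG hτ hP
  have hneg : μ < 0 := by linarith
  rw [abs_of_neg hneg] at h1
  refine ⟨μ, _, hμ, hasEigenvalue_det_div hneg.ne hμ, by linarith, div_pos_of_neg_of_neg hdet.2 hneg, ?_⟩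
  rw [div_lt_one_of_neg hneg]
  linarith [hdet.1]

theorem hasPreservingEigenvalues (hG : HyperbolicFor G H.lam H.Cu H.Cs)
    (hτ : HasSign G H.Cu 0 1) {P : Plane} (hdet : (fderiv ℝ G P).det ∈ Ioo (-1 : ℝ) 0) :
    HasPreservingEigenvalues H G P where
  eigen := by
    intro lam₁ lam₂ v w hv hw hvK h1 h2
    have hAv : fderiv ℝ G P v = lam₁ • v := hv.apply_eq_smul
    have hAw : fderiv ℝ G P w = lam₂ • w := hw.apply_eq_smul
    -- The vector `v` is only known to lie in the universal cone, where `HasSign` is silent. It is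
    -- paired with a stable vector whose image reverses vertical direction; that reversal cancels
    -- the negative determinant.
    have hpos : 0 < lam₁ := by
      set s' := H.Cs.axis (G P) with hs'
      have hs'm : s' ∈ H.Cs.at (G P) := H.Cs.axis_mem _
      have hs'0 : s' ≠ 0 := H.Cs.axis_ne_zero _
      have h3 := H.stable_sign hG hτ hdet.2 hs'm hs'0
      have hAs : fderiv ℝ G P (fderiv ℝ G.symm (G P) s') = s' := G.apply_fderiv_symm P s'
      have hsm := H.fderiv_symm_mem hG hs'm
      set s := fderiv ℝ G.symm (G P) s' with hs
      have hs0 : s ≠ 0 := by intro h; rw [h, map_zero] at hAs; exact hs'0 hAs.symm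
      have c1 := H.K.cross_mul_pos hvK (H.stable_subset _ hsm) hv.2 hs0
      have c2 := H.K.cross_mul_pos hvK (H.stable_subset _ hs'm) hv.2 hs'0
      have c3 := cross_map (fderiv ℝ G P) v s
      rw [hAv, hAs] at c3
      have c4 : cross (lam₁ • v) s' = lam₁ * cross v s' := by
        simp only [cross, PiLp.smul_apply, smul_eq_mul]; ring
      rw [c4] at c3
      have c5 := mul_pos c1 c2
      have hD := hdet.2
      set D := (fderiv ℝ G P).det
      have c6 : cross v s * (v 0 * s 1) * (cross v s' * (v 0 * s' 1)) * lam₁ =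
          (cross v s * v 0) ^ 2 * (D * (1 * (s' 1 * s 1))) := by
        linear_combination (cross v s * v 0 ^ 2 * s 1 * s' 1) * c3
      have c7 : 0 < D * (1 * (s' 1 * s 1)) := mul_pos_of_neg_of_neg hD h3
      have c8 : 0 < (cross v s * v 0) ^ 2 := by
        refine lt_of_le_of_ne (sq_nonneg _) fun h => ?_
        have h' : cross v s * v 0 = 0 := pow_eq_zero_iff two_ne_zero |>.1 h.symm
        rw [← mul_assoc, h', zero_mul] at c1
        exact lt_irrefl _ c1
      exact pos_of_mul_pos_right (c6 ▸ mul_pos c8 c7) c5.le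
    rw [abs_of_pos hpos] at h1
    refine ⟨h1, ?_⟩
    have hne : lam₁ ≠ lam₂ := by
      rintro rfl
      rw [abs_of_pos hpos] at h2
      exact lt_asymm h1 h2
    -- Independence of the eigenvectors reduces the transformation rule to `lam₁ * lam₂ = det`.
    have hc := cross_ne_zero_of_hasEigenvector hv hw hne
    have h3 := cross_map (fderiv ℝ G P) v w
    have h4 : cross (lam₁ • v) (lam₂ • w) = lam₁ * lam₂ * cross v w := by
      simp only [cross, PiLp.smul_apply, smul_eq_mul]; ring
    rw [hAv, hAw, h4] at h3
    have h5 := mul_right_cancel₀ hc h3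
    have h6 := hdet.2
    rw [← h5] at h6
    exact neg_of_mul_neg_right h6 hpos.le
  fixed := by
    intro hP
    obtain ⟨μ, hμ, h1, h2⟩ := H.exists_eigenvalue_of_fixedPoint hG hτ hP
    rw [one_mul] at h2
    rw [abs_of_pos h2] at h1
    refine ⟨μ, _, hμ, hasEigenvalue_det_div h2.ne' hμ, h1, ?_, div_neg_of_neg_of_pos hdet.2 h2⟩
    rw [lt_div_iff₀ h2]
    linarith [hdet.1]
  unstable := by
    intro e he hn hpos
    have he0 : e ≠ 0 := by rintro rfl; simp at hn
    have h1 := hG.expand_unstable P e he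
    rw [hn, mul_one] at h1
    have h2 := hτ P e he he0
    set y := fderiv ℝ G P e with hy
    have hyn : 1 < ‖y‖ := H.one_lt_lam.trans_le h1
    have hy0 : 0 < ‖y‖ := zero_lt_one.trans hyn
    refine ⟨‖y‖⁻¹ • y, H.Cu.smul_mem _ (hG.map_unstable P e he), ?_, ?_, ‖y‖, hyn, ?_⟩
    · rw [norm_smul, norm_inv, norm_norm, inv_mul_cancel₀ hy0.ne']
    · rw [one_mul] at h2
      exact mul_pos (inv_pos.2 hy0) (pos_of_mul_pos_right h2 hpos.le)
    · rw [smul_inv_smul₀ hy0.ne']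
  stable := by
    intro e' he' hn hpos
    have he0 : e' ≠ 0 := by rintro rfl; simp at hn
    have h1 := hG.expand_stable (G P) e' he'
    rw [hn, mul_one] at h1
    have h2 := H.stable_sign hG hτ hdet.2 he' he0
    have hAz := G.apply_fderiv_symm P e'
    have hzm := H.fderiv_symm_mem hG he'
    set z := fderiv ℝ G.symm (G P) e' with hz
    have hzn : 1 < ‖z‖ := H.one_lt_lam.trans_le h1
    have hz0 : 0 < ‖z‖ := zero_lt_one.trans hzn
    have hz1 : z 1 < 0 := by
      rw [one_mul] at h2
      exact neg_of_mul_neg_right h2 hpos.le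
    -- The preimage `z` points downwards and is longer than 1, so reversing and normalizing it
    -- yields the multiplier `-‖z‖⁻¹`.
    refine ⟨(-‖z‖⁻¹) • z, H.Cs.smul_mem _ hzm, ?_, ?_, -‖z‖⁻¹, ?_, ?_, ?_⟩
    · rw [norm_smul, norm_neg, norm_inv, norm_norm, inv_mul_cancel₀ hz0.ne']
    · exact mul_pos_of_neg_of_neg (neg_lt_zero.2 (inv_pos.2 hz0)) hz1
    · exact neg_lt_neg (inv_lt_one_of_one_lt₀ hzn)
    · exact neg_lt_zero.2 (inv_pos.2 hz0)
    · rw [map_smul, hAz]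

/-! ### Transfer to the piecewise map -/

theorem map_eventuallyEq_left {P : Plane} (hP : P ∈ H.left) : H.map =ᶠ[nhds P] F₁ := by
  filter_upwards [H.isOpen_left.mem_nhds hP] with Q hQ
  exact H.map_of_le (le_of_lt hQ)

theorem map_eventuallyEq_right {P : Plane} (hP : P ∈ H.right) : H.map =ᶠ[nhds P] F₂ := by
  filter_upwards [H.isOpen_right.mem_nhds hP] with Q hQ
  exact H.map_of_ge (le_of_lt hQ)

theorem notMem_divider_of_mem {X : Plane} (h : X ∈ H.left ∨ X ∈ H.right) : X ∉ H.divider := by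
  intro hX
  rcases h with h | h
  · exact (ne_of_lt h) hX
  · exact (ne_of_gt h) hX

/-- A fixed point off the divider is not in the image of the divider. -/
theorem notMem_image_divider {X : Plane} (hfix : H.map X = X) (hX : X ∉ H.divider) :
    X ∉ H.map '' H.divider := by
  rintro ⟨Y, hY, hYX⟩
  have hY' : Y 0 = H.g (Y 1) := hY
  have h1 : F₁ Y = X := by rw [← H.map_of_le hY'.le, hYX]
  have h2 : F₂ Y = X := by rw [← H.map_of_ge hY'.ge, hYX]
  -- Both branches send `Y` to `X`, and one of them fixes `X`.
  have : X = Y := by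
    rcases le_total (X 0) (H.g (X 1)) with h | h
    · rw [H.map_of_le h] at hfix
      exact F₁.injective (hfix.trans h1.symm)
    · rw [H.map_of_ge h] at hfix
      exact F₂.injective (hfix.trans h2.symm)
  exact hX (this ▸ hY)

/-- All fixed points in `D` lie on the side of the reversing branch, hence are fixed points of one
hyperbolic diffeomorphism. -/
theorem existsUnique_fixedPoint {D : Set Plane} (hD : IsDiskTrappingRegion H.map D) :
    ∃! X : Plane, X ∈ D ∧ H.map X = X := by
  obtain ⟨X, hX, hfix⟩ := H.exists_fixedPoint hD
  refine ⟨X, ⟨hX, hfix⟩, fun Y hY => ?_⟩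
  rcases H.sign_cases hD with ⟨h₁, -⟩ | ⟨-, h₂⟩
  · have hXr : H.g (X 1) ≤ X 0 := le_of_lt (H.fixedPoint_mem_right hD h₁ hX hfix)
    have hYr : H.g (Y 1) ≤ Y 0 := le_of_lt (H.fixedPoint_mem_right hD h₁ hY.1 hY.2)
    exact H.fixedPoint_unique H.hyperbolic₂ (by rw [← H.map_of_ge hYr, hY.2])
      (by rw [← H.map_of_ge hXr, hfix])
  · have hXr : X 0 ≤ H.g (X 1) := le_of_lt (H.fixedPoint_mem_left hD h₂ hX hfix)
    have hYr : Y 0 ≤ H.g (Y 1) := le_of_lt (H.fixedPoint_mem_left hD h₂ hY.1 hY.2)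
    exact H.fixedPoint_unique H.hyperbolic₁ (by rw [← H.map_of_le hYr, hY.2])
      (by rw [← H.map_of_le hXr, hfix])

end SynchronouslyHyperbolic
end LoziLike

theorem mainTheorem7 (F₁ F₂ : LoziLike.PlaneDiffeo)
    (H : LoziLike.SynchronouslyHyperbolic F₁ F₂) (_hF : LoziLike.IsLoziLike H)
    (Δ : Set LoziLike.Plane) (_hΔ : LoziLike.IsDiskTrappingRegion H.map Δ) :
    (Δ ∩ H.divider).Nonempty ∧ (Δ ∩ H.map '' H.divider).Nonempty ∧
    (∃! X : LoziLike.Plane, X ∈ Δ ∧ H.map X = X) ∧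
    ∀ X : LoziLike.Plane, X ∈ Δ → H.map X = X →
      (X ∈ H.right →
        LoziLike.HasFlippingEigenvalues (fderiv ℝ H.map X) ∧
        ∀ P ∈ H.left, HasFDerivAt H.map (fderiv ℝ F₁ P) P ∧
          LoziLike.HasPreservingEigenvalues H F₁ P) ∧
      (X ∈ H.left →
        LoziLike.HasFlippingEigenvalues (fderiv ℝ H.map X) ∧
        ∀ P ∈ H.right, HasFDerivAt H.map (fderiv ℝ F₂ P) P ∧
          LoziLike.HasPreservingEigenvalues H F₂ P) ∧
      X ∉ H.divider ∩ H.map '' H.divider ∧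
      X ∉ H.divider ∪ H.map '' H.divider := by
  obtain ⟨P, hPΔ, hPΓ⟩ := H.inter_divider_nonempty _hΔ
  refine ⟨⟨P, hPΔ, hPΓ⟩, ⟨H.map P, _hΔ.trapping.map_mem hPΔ, mem_image_of_mem _ hPΓ⟩,
    H.existsUnique_fixedPoint _hΔ, fun X hX hfix => ?_⟩
  have hside : X ∈ H.left ∨ X ∈ H.right := by
    rcases H.sign_cases _hΔ with ⟨h₁, -⟩ | ⟨-, h₂⟩
    · exact Or.inr (H.fixedPoint_mem_right _hΔ h₁ hX hfix)
    · exact Or.inl (H.fixedPoint_mem_left _hΔ h₂ hX hfix)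
  have hΓ := H.notMem_divider_of_mem hside
  refine ⟨fun hr => ?_, fun hl => ?_, fun h => hΓ h.1, fun h => ?_⟩
  · rcases H.sign_cases _hΔ with ⟨h₁, h₂⟩ | ⟨-, h₂⟩
    · refine ⟨?_, fun P hP => ⟨?_, H.hasPreservingEigenvalues H.hyperbolic₁ h₁ (_hF.det₁ P)⟩⟩
      · rw [(H.map_eventuallyEq_right hr).fderiv_eq]
        exact H.hasFlippingEigenvalues H.hyperbolic₂ h₂
          (by rw [← H.map_of_ge (le_of_lt hr), hfix]) (_hF.det₂ X)
      · exact (F₁.hasFDerivAt P).congr_of_eventuallyEq (H.map_eventuallyEq_left hP)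
    · exact (disjoint_left.1 H.disjoint_left_right
        (H.fixedPoint_mem_left _hΔ h₂ hX hfix) hr).elim
  · rcases H.sign_cases _hΔ with ⟨h₁, -⟩ | ⟨h₁, h₂⟩
    · exact (disjoint_left.1 H.disjoint_left_right hl
        (H.fixedPoint_mem_right _hΔ h₁ hX hfix)).elim
    · refine ⟨?_, fun P hP => ⟨?_, H.hasPreservingEigenvalues H.hyperbolic₂ h₂ (_hF.det₂ P)⟩⟩
      · rw [(H.map_eventuallyEq_left hl).fderiv_eq]
        exact H.hasFlippingEigenvalues H.hyperbolic₁ h₁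
          (by rw [← H.map_of_le (le_of_lt hl), hfix]) (_hF.det₁ X)
      · exact (F₂.hasFDerivAt P).congr_of_eventuallyEq (H.map_eventuallyEq_right hP)
  · rcases h with h | h
    · exact hΓ h
    · exact H.notMem_image_divider hfix hΓ h
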